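/- Let $I_\nu$ ($\nu=0,1,\dots$) be the modified Bessel function of the first kind and $A_1(\kappa)=I_1(\kappa)/I_0(\kappa)$. Let $\theta_1,\theta_2,\dots$ be independent angles in $[0,2\pi)$ with the von Mises density $\exp\{\kappa\cos(\theta-\theta_0)\}/\{2\pi I_0(\kappa)\}$, where $\kappa>0$ and $\theta_0\in\mathbb{R}$ are both unknown. From $\theta_1,\dots,\theta_n$, let $\hat\theta_0=\operatorname{atan2}(\sum_h\sin\theta_h,\sum_h\cos\theta_h)$. The hybrid score matching estimator $\hat\kappa_{\mathrm{SME}}$ of $\kappa$ is the minimizer over $k\in\mathbb{R}$ of the score matching criterion $$\frac1n\sum_{h=1}^n \tfrac12\left\{\left(\frac{d\log f_k}{d\varphi}\right)^2+2\,\frac{d^2\log f_k}{d\varphi^2}\right\}(\theta_h-\hat\theta_0),\qquad f_k(\varphi)=\frac{e^{k\cos\varphi}}{2\pi I_0(k)},$$ and the maximum likelihood estimator $\hat\kappa_{\mathrm{MLE}}$ is the concentration component of a maximizer of the likelihood of $\theta_1,\dots,\theta_n$ over all $(\theta_0,\kappa)\in\mathbb{R}\times[0,\infty)$. Put the estimators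 equal to $0$ for samples where they do not exist. An estimator $\hat\kappa$ is said to have asymptotic variance $v>0$ if $\sqrt n(\hat\kappa-\kappa)$ converges in distribution to $N(0,v)$ as $n\to\infty$. For every $\kappa>0$ and $\theta_0$: 1. For each $n\ge2$, both $\hat\kappa_{\mathrm{SME}}$ and $\hat\kappa_{\mathrm{MLE}}$ almost surely exist and are unique. 2. $\hat\kappa_{\mathrm{SME}}$ has asymptotic variance $$v_{\mathrm{SME}}(\kappa)=\frac{\kappa\{2\kappa-3A_1(\kappa)\}}{A_1^2(\kappa)}.$$ 3. $\hat\kappa_{\mathrm{MLE}}$ has asymptotic variance $$v_{\mathrm{MLE}}(\kappa)=\frac{1}{1-A_1^2(\kappa)-A_1(\kappa)/\kappa}.$$ 4. Hence the asymptotic relative efficiency of $\hat\kappa_{\mathrm{SME}}$ relative to $\hat\kappa_{\mathrm{MLE}}$, the ratio of the asymptotic variance of $\hat\kappa_{\mathrm{MLE}}$ to that of $\hat\kappa_{\mathrm{SME}}$, is $$\mathrm{ARE}(\kappa)=\frac{A_1^2(\kappa)}{\{2\kappa-3A_1(\kappa)\}\{\kappa-\kappa A_1^2(\kappa)-A_1(\kappa)\}}.$$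 Moreover, both $v_{\mathrm{SME}}(\kappa)$ and $v_{\mathrm{MLE}}(\kappa)$ tend to $2$ as $\kappa\downarrow0$ and are asymptotically equivalent to $2\kappa^2$ as $\kappa\to\infty$, and $\mathrm{ARE}(\kappa)\to1$ both as $\kappa\downarrow0$ and as $\kappa\to\infty$. -/

import Mathlib

open MeasureTheory ProbabilityTheory Filter Topology

noncomputable section

namespace VonMises

/-- The modified Bessel function of the first kind of integer order `ν ≥ 0`,
`I_ν(x) = (1 / 2π) ∫₀^{2π} cos (ν t) exp (x cos t) dt`. -/
def besselI (ν : ℕ) (x : ℝ) : ℝ :=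
  (2 * Real.pi)⁻¹ *
    ∫ t in (0 : ℝ)..(2 * Real.pi), Real.cos (ν * t) * Real.exp (x * Real.cos t)

/-- The ratio `A_ν(κ) = I_ν(κ) / I_0(κ)`. -/
def besselA (ν : ℕ) (κ : ℝ) : ℝ := besselI ν κ / besselI 0 κ

/-- The von Mises density with orientation angle `θ₀` and concentration `κ`, with respect to
the uniform measure `dθ` on the circle, as a `2π`-periodic function of the angle. -/
def density (θ₀ κ θ : ℝ) : ℝ :=
  Real.exp (κ * Real.cos (θ - θ₀)) / (2 * Real.pi * besselI 0 κ)

/-- The von Mises distribution of an angle in `[0, 2π)`. -/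
def law (θ₀ κ : ℝ) : Measure ℝ :=
  (volume.restrict (Set.Ico 0 (2 * Real.pi))).withDensity
    fun θ => ENNReal.ofReal (density θ₀ κ θ)

/-- The empirical score matching criterion on the circle,
`Ψ(f; F_n) = (1/n) ∑ ½ {⟨log f, log f⟩ + 2 Δ log f}(φ_h)`. In the angular coordinate the metric
is `1`, so the gradient inner product is the squared derivative and the Laplace-Beltrami operator
is the second derivative. -/
def scoreCriterion {n : ℕ} (f : ℝ → ℝ) (φ : Fin n → ℝ) : ℝ :=
  (n : ℝ)⁻¹ * ∑ h, (1 / 2) *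
    ((deriv (fun x => Real.log (f x)) (φ h)) ^ 2 +
      2 * deriv (deriv fun x => Real.log (f x)) (φ h))

/-- The estimated orientation `atan2 (S̄, C̄)`, the direction of the mean of the `exp (i θ_h)`. -/
def meanDirection {n : ℕ} (θ : Fin n → ℝ) : ℝ :=
  Complex.arg (∑ h, Complex.exp (θ h * Complex.I))

/-- The standardized data: angles measured from the estimated orientation. -/
def standardize {n : ℕ} (θ : Fin n → ℝ) : Fin n → ℝ := fun h => θ h - meanDirection θ

/-- `k` is a score matching estimate of the concentration, for the standardized data, in the
reduced model: the exponential family `∝ exp (κ cos φ)`, `κ ∈ ℝ`, with orientation `0`. -/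
def IsHybridSME {n : ℕ} (θ : Fin n → ℝ) (k : ℝ) : Prop :=
  ∀ k' : ℝ, scoreCriterion (density 0 k) (standardize θ) ≤
    scoreCriterion (density 0 k') (standardize θ)

/-- The likelihood of the full model with parameters `θ₀` and `κ`. -/
def likelihood {n : ℕ} (θ : Fin n → ℝ) (θ₀ κ : ℝ) : ℝ := ∏ h, density θ₀ κ (θ h)

/-- `(m, k)` maximizes the likelihood of the full model over all orientations and all
concentrations `κ ≥ 0`. -/
def IsMLE {n : ℕ} (θ : Fin n → ℝ) (m k : ℝ) : Prop :=
  0 ≤ k ∧ ∀ m' k' : ℝ, 0 ≤ k' → likelihood θ m' k' ≤ likelihood θ m k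

/-- `k` is the concentration part of a maximum likelihood estimate in the full model. -/
def IsConcentrationMLE {n : ℕ} (θ : Fin n → ℝ) (k : ℝ) : Prop := ∃ m, IsMLE θ m k

open Classical in
/-- The hybrid score matching estimator of `κ` (with value `0` if there is none). -/
def hybridSME {n : ℕ} (θ : Fin n → ℝ) : ℝ :=
  if h : ∃ k, IsHybridSME θ k then h.choose else 0

open Classical in
/-- The maximum likelihood estimator of `κ` (with value `0` if there is none). -/
def concentrationMLE {n : ℕ} (θ : Fin n → ℝ) : ℝ :=
  if h : ∃ k, IsConcentrationMLE θ k then h.choose else 0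

/-- The first `n` observations of a sequence. -/
def sample {Ω : Type*} (X : ℕ → Ω → ℝ) (n : ℕ) (ω : Ω) : Fin n → ℝ := fun h => X h ω

/-- The estimators `T n` of the number `τ` have the (nonzero) asymptotic variance `v`:
`√n (T n - τ)` converges in distribution to `N(0, v)`. -/
def HasAsymptoticVariance {Ω : Type*} [MeasurableSpace Ω] (P : Measure Ω)
    [IsProbabilityMeasure P] (T : ℕ → Ω → ℝ) (τ v : ℝ) : Prop :=
  0 < v ∧
    TendstoInDistribution (fun (n : ℕ) ω => Real.sqrt n * (T n ω - τ)) atTop (id : ℝ → ℝ)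
      (fun _ => P) (gaussianReal 0 v.toNNReal)

/-- `e` is the asymptotic relative efficiency of the estimators `T n` of `τ` relative to the
estimators `S n`: the asymptotic variance of `S` divided by that of `T`. -/
def IsAsymptoticRelativeEfficiency {Ω : Type*} [MeasurableSpace Ω] (P : Measure Ω)
    [IsProbabilityMeasure P] (T S : ℕ → Ω → ℝ) (τ e : ℝ) : Prop :=
  ∃ v w : ℝ, HasAsymptoticVariance P T τ v ∧ HasAsymptoticVariance P S τ w ∧ e = w / v

end VonMises

end

/-!
Write `φ = θ - θ₀` and let `E` be the expectation under the von Mises distribution of orientation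
`0`. Differentiating under the integral gives `A₁' = Var (cos φ) > 0`, and integration by parts
gives Stein's identity `κ E (g sin φ) = E g'` (`mul_expect_mul_sin`), from which
`E sin² φ = A₁ / κ`, `A₁' = 1 - A₁² - A₁ / κ` and
`E (cos φ - κ sin² φ)² = 2 - 3 A₁ / κ` follow.

For a fixed sample both estimators are explicit. Let `r` be the mean resultant length and `a` the
mean of `sin²` of the angles measured from the estimated orientation. The score matching criterion
is the quadratic polynomial `a k² / 2 - r k`, so its minimizer is `r / a` (`hybridSME_eq`). The
likelihood maximized over the orientation is a strictly concave function of `k` on the logarithmic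
scale, with critical point `A₁ k = r`, so the maximum likelihood estimator is `A₁⁻¹ r`
(`concentrationMLE_eq`). Two independent angles almost surely do not differ by a multiple of `π`,
which yields `a > 0` and `r < 1`, that is, existence and uniqueness.

Let `c`, `s`, `q` be the sample means of `cos φ`, `sin φ`, `sin² φ`. Rotating from the true to the
estimated orientation changes `c` to `r` and `q` to `a`; both differences are `s` times a quantity
that tends to `0` almost surely, while `√n s` converges in distribution. Hence
`√n (r / a - κ) = √n (r - κ a) / a` behaves as `√n (c - κ q) / a`, and `√n (A₁⁻¹ r - κ)` as
`√n (c - A₁) / A₁'`. The central limit theorem, the strong law of large numbers and Slutsky's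
theorem (`MeasureTheory.TendstoInDistribution.of_eventually_eq_mul_add`) give the asymptotic
variances `(2 - 3 A₁ / κ) / (A₁ / κ)²` and `1 / A₁'`.

As `κ → 0` it suffices that `A₁ / κ → A₁' 0 = 1 / 2`. As `κ → ∞`, the variable `κ (1 - cos φ)` has
bounded moments (`exists_pow_mul_versineMoment_le`), so that Stein's identity determines the limits
of its first two moments, `1 / 2` and `3 / 4`; hence `κ² A₁' → 1 / 2` (`tendsto_sq_mul_varCos`).
-/

namespace VonMises

/-! ### Expectations under the von Mises distribution -/

/-- The integral of `h` over one period against the unnormalized von Mises weight. -/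
noncomputable def expInt (κ : ℝ) (h : ℝ → ℝ) : ℝ :=
  ∫ t in (0 : ℝ)..(2 * Real.pi), h t * Real.exp (κ * Real.cos t)

/-- The expectation of `h φ` for an angle `φ` with the von Mises distribution of orientation `0`
and concentration `κ`. -/
noncomputable def expect (κ : ℝ) (h : ℝ → ℝ) : ℝ := expInt κ h / expInt κ fun _ => 1

theorem intervalIntegrable_weight {κ : ℝ} {h : ℝ → ℝ} (hh : Continuous h) (a b : ℝ) :
    IntervalIntegrable (fun t => h t * Real.exp (κ * Real.cos t)) volume a b :=
  (by fun_prop : Continuous fun t => h t * Real.exp (κ * Real.cos t)).intervalIntegrable _ _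

theorem expInt_pos {κ : ℝ} {h : ℝ → ℝ} (hh : Continuous h) (h0 : ∀ t, 0 ≤ h t)
    (h1 : ∃ c ∈ Set.Icc 0 (2 * Real.pi), 0 < h c) : 0 < expInt κ h := by
  obtain ⟨c, hc, hc'⟩ := h1
  exact intervalIntegral.integral_pos (by positivity) (by fun_prop)
    (fun x _ => mul_nonneg (h0 x) (Real.exp_pos _).le) ⟨c, hc, by positivity⟩

theorem expInt_one_pos (κ : ℝ) : 0 < expInt κ fun _ => 1 :=
  expInt_pos continuous_const (fun _ => zero_le_one) ⟨0, ⟨le_rfl, by positivity⟩, one_pos⟩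

theorem expect_pos {κ : ℝ} {h : ℝ → ℝ} (hh : Continuous h) (h0 : ∀ t, 0 ≤ h t)
    (h1 : ∃ c ∈ Set.Icc 0 (2 * Real.pi), 0 < h c) : 0 < expect κ h :=
  div_pos (expInt_pos hh h0 h1) (expInt_one_pos κ)

theorem expect_one (κ : ℝ) : expect κ (fun _ => 1) = 1 := div_self (expInt_one_pos κ).ne'

theorem expect_linear {κ : ℝ} {f g : ℝ → ℝ} (hf : Continuous f) (hg : Continuous g) (a b : ℝ) :
    expect κ (fun t => a * f t + b * g t) = a * expect κ f + b * expect κ g := by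
  have : expInt κ (fun t => a * f t + b * g t) = a * expInt κ f + b * expInt κ g := by
    unfold expInt
    rw [← intervalIntegral.integral_const_mul, ← intervalIntegral.integral_const_mul,
      ← intervalIntegral.integral_add ((intervalIntegrable_weight hf _ _).const_mul a)
        ((intervalIntegrable_weight hg _ _).const_mul b)]
    congr 1; ext t; ring
  unfold expect
  rw [this]; ring

/-- Stein's identity for the von Mises distribution: the derivative of `g t * exp (κ cos t)`
integrates to zero over a period. -/
theorem mul_expect_mul_sin {κ : ℝ} {f g g' : ℝ → ℝ} (hg : ∀ t, HasDerivAt g (g' t) t)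
    (hc : Continuous g') (hp : g (2 * Real.pi) = g 0) (hf : ∀ t, f t = g t * Real.sin t) :
    κ * expect κ f = expect κ g' := by
  have hgc : Continuous g := continuous_iff_continuousAt.2 fun t => (hg t).continuousAt
  have key : expInt κ (fun t => 1 * g' t + (-κ) * (g t * Real.sin t)) = 0 := by
    unfold expInt
    rw [intervalIntegral.integral_eq_sub_of_hasDerivAt
      (f := fun t => g t * Real.exp (κ * Real.cos t))]
    · simp [hp]
    · intro t _
      convert! (hg t).mul (((Real.hasDerivAt_cos t).const_mul κ).exp) using 1
      ring
    · exact intervalIntegrable_weight (by fun_prop) _ _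
  have h2 : expect κ (fun t => 1 * g' t + (-κ) * (g t * Real.sin t)) = 0 := by
    rw [expect, key, zero_div]
  rw [expect_linear (g := fun t => g t * Real.sin t) hc (by fun_prop)] at h2
  rw [funext hf]
  linarith

theorem hasDerivAt_expInt {h : ℝ → ℝ} (hh : Continuous h) (κ : ℝ) :
    HasDerivAt (fun κ => expInt κ h) (expInt κ fun t => h t * Real.cos t) κ := by
  refine (intervalIntegral.hasDerivAt_integral_of_dominated_loc_of_deriv_le
    (F' := fun x t => h t * Real.cos t * Real.exp (x * Real.cos t))
    (bound := fun t => |h t| * Real.exp (|κ| + 1))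
    (Metric.ball_mem_nhds κ one_pos) (Eventually.of_forall fun x => ?_)
    (intervalIntegrable_weight hh _ _) ?_ (ae_of_all _ fun t _ x hx => ?_) ?_
    (ae_of_all _ fun t _ x _ => ?_)).2
  · exact (by fun_prop : Continuous fun t => h t * Real.exp (x * Real.cos t)).aestronglyMeasurable
  · exact (by fun_prop : Continuous fun t =>
      h t * Real.cos t * Real.exp (κ * Real.cos t)).aestronglyMeasurable
  · rw [norm_mul, Real.norm_eq_abs, Real.norm_eq_abs, Real.abs_exp, abs_mul]
    have hx' : |x| ≤ |κ| + 1 := by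
      rw [Metric.mem_ball, Real.dist_eq] at hx
      have := abs_add_le κ (x - κ)
      rw [add_sub_cancel] at this
      linarith
    have h2 : x * Real.cos t ≤ |κ| + 1 := by
      refine (le_abs_self _).trans ?_
      rw [abs_mul]
      exact (mul_le_of_le_one_right (abs_nonneg _) (Real.abs_cos_le_one t)).trans hx'
    exact mul_le_mul (mul_le_of_le_one_right (abs_nonneg _) (Real.abs_cos_le_one t))
      (Real.exp_le_exp.2 h2) (Real.exp_pos _).le (abs_nonneg _)
  · exact (by fun_prop : Continuous fun t => |h t| * Real.exp (|κ| + 1)).intervalIntegrable _ _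
  · convert! ((hasDerivAt_id x).mul_const (Real.cos t)).exp.const_mul (h t) using 1
    simp; ring

theorem continuous_expInt {h : ℝ → ℝ} (hh : Continuous h) : Continuous fun κ => expInt κ h :=
  continuous_iff_continuousAt.2 fun κ => (hasDerivAt_expInt hh κ).continuousAt

theorem continuous_expect {h : ℝ → ℝ} (hh : Continuous h) : Continuous fun κ => expect κ h :=
  (continuous_expInt hh).div (continuous_expInt continuous_const) fun κ => (expInt_one_pos κ).ne'

/-! ### The Bessel function ratio `A₁` -/

theorem besselI_zero (κ : ℝ) : besselI 0 κ = (2 * Real.pi)⁻¹ * expInt κ fun _ => 1 := by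
  simp [besselI, expInt]

theorem two_pi_mul_besselI_zero (κ : ℝ) : 2 * Real.pi * besselI 0 κ = expInt κ fun _ => 1 := by
  rw [besselI_zero, mul_inv_cancel_left₀ (by positivity)]

theorem besselA_one_eq (κ : ℝ) : besselA 1 κ = expect κ Real.cos := by
  rw [besselA, besselI_zero, expect, besselI, mul_div_mul_left _ _ (by positivity)]
  simp [expInt]

/-- The variance of `cos φ` under the von Mises distribution; it is the derivative of `A₁`. -/
noncomputable def varCos (κ : ℝ) : ℝ := expect κ (fun t => Real.cos t ^ 2) - besselA 1 κ ^ 2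

theorem hasDerivAt_besselA (κ : ℝ) : HasDerivAt (besselA 1) (varCos κ) κ := by
  have h := (hasDerivAt_expInt Real.continuous_cos κ).div
    (hasDerivAt_expInt (continuous_const (y := (1 : ℝ))) κ) (expInt_one_pos κ).ne'
  have e : besselA 1 = fun κ => expInt κ Real.cos / expInt κ fun _ => 1 :=
    funext fun κ => besselA_one_eq κ
  rw [e]
  convert! h using 1
  have := (expInt_one_pos κ).ne'
  have e1 : (fun t => 1 * Real.cos t) = Real.cos := by ext; simp
  have e2 : (fun t => Real.cos t * Real.cos t) = fun t => Real.cos t ^ 2 := by ext; ring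
  rw [varCos, besselA_one_eq, expect, expect, e1, e2]
  field_simp

theorem continuous_varCos : Continuous varCos := by
  refine (continuous_expect (by fun_prop)).sub (Continuous.pow ?_ 2)
  exact continuous_iff_continuousAt.2 fun κ => (hasDerivAt_besselA κ).continuousAt

theorem hasStrictDerivAt_besselA (κ : ℝ) : HasStrictDerivAt (besselA 1) (varCos κ) κ :=
  hasStrictDerivAt_of_hasDerivAt_of_continuousAt
    (Eventually.of_forall fun x => hasDerivAt_besselA x) continuous_varCos.continuousAt

theorem expect_sq_sub {κ : ℝ} {f : ℝ → ℝ} (hf : Continuous f) (m : ℝ) :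
    expect κ (fun t => (f t - m) ^ 2) =
      expect κ (fun t => f t ^ 2) - 2 * m * expect κ f + m ^ 2 := by
  have e : (fun t => (f t - m) ^ 2) =
      fun t => 1 * (1 * f t ^ 2 + (-2 * m) * f t) + m ^ 2 * 1 := by ext; ring
  rw [e, expect_linear (by fun_prop) continuous_const, expect_linear (by fun_prop) hf, expect_one]
  ring

/-- The variance of a non-constant function: `cos φ` differs from its mean at `φ = 0` or at
`φ = π`. -/
theorem varCos_pos (κ : ℝ) : 0 < varCos κ := by
  have h : varCos κ = expect κ fun t => (Real.cos t - besselA 1 κ) ^ 2 := by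
    rw [expect_sq_sub Real.continuous_cos, varCos, ← besselA_one_eq]; ring
  rw [h]
  refine expect_pos (by fun_prop) (fun _ => sq_nonneg _) ?_
  by_cases h1 : besselA 1 κ = 1
  · refine ⟨Real.pi, ⟨Real.pi_pos.le, by linarith [Real.pi_pos]⟩, ?_⟩
    rw [h1, Real.cos_pi]; norm_num
  · refine ⟨0, ⟨le_rfl, by positivity⟩, ?_⟩
    rw [Real.cos_zero]
    exact sq_pos_of_ne_zero (sub_ne_zero.2 (Ne.symm h1))

theorem strictMono_besselA : StrictMono (besselA 1) :=
  strictMono_of_deriv_pos fun κ => by rw [(hasDerivAt_besselA κ).deriv]; exact varCos_pos κ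

theorem continuous_besselA : Continuous (besselA 1) :=
  continuous_iff_continuousAt.2 fun κ => (hasDerivAt_besselA κ).continuousAt

theorem besselA_zero : besselA 1 0 = 0 := by
  rw [besselA_one_eq, expect, expInt]; simp

theorem besselA_pos {κ : ℝ} (h : 0 < κ) : 0 < besselA 1 κ := by
  simpa [besselA_zero] using strictMono_besselA h

theorem besselA_lt_one (κ : ℝ) : besselA 1 κ < 1 := by
  have h : 0 < expect κ fun t => 1 * 1 + (-1) * Real.cos t := by
    refine expect_pos (by fun_prop) (fun t => by linarith [Real.cos_le_one t])
      ⟨Real.pi, ⟨Real.pi_pos.le, by linarith [Real.pi_pos]⟩, by rw [Real.cos_pi]; norm_num⟩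
  rw [expect_linear continuous_const Real.continuous_cos, expect_one, ← besselA_one_eq] at h
  linarith

theorem mul_expect_sin_sq (κ : ℝ) : κ * expect κ (fun t => Real.sin t ^ 2) = besselA 1 κ := by
  rw [besselA_one_eq]
  exact mul_expect_mul_sin Real.hasDerivAt_sin Real.continuous_cos (by simp) fun t => by ring

theorem expect_sin {κ : ℝ} (h : κ ≠ 0) : expect κ Real.sin = 0 := by
  have h1 := mul_expect_mul_sin (κ := κ) (f := Real.sin) (g := fun _ => 1) (g' := fun _ => 0)
    (fun t => hasDerivAt_const t 1) continuous_const rfl fun t => (one_mul _).symm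
  have h0 : expect κ (fun _ => 0) = 0 := by simp [expect, expInt]
  rw [h0] at h1
  exact (mul_eq_zero.1 h1).resolve_left h

theorem expect_sin_mul_cos {κ : ℝ} (h : κ ≠ 0) :
    expect κ (fun t => Real.sin t * Real.cos t) = 0 := by
  have h1 := mul_expect_mul_sin (κ := κ) (f := fun t => Real.sin t * Real.cos t) (g := Real.cos)
    (g' := fun t => (-1) * Real.sin t + 0 * Real.sin t)
    (fun t => by simpa using Real.hasDerivAt_cos t) (by fun_prop) (by simp) fun t => mul_comm _ _
  rw [expect_linear Real.continuous_sin Real.continuous_sin, expect_sin h] at h1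
  simpa [h] using h1

theorem expect_cos_sq (κ : ℝ) :
    expect κ (fun t => Real.cos t ^ 2) = 1 - expect κ (fun t => Real.sin t ^ 2) := by
  have e : (fun t => Real.cos t ^ 2) = fun t => 1 * 1 + (-1) * Real.sin t ^ 2 := by
    ext t; rw [Real.cos_sq']; ring
  rw [e, expect_linear continuous_const (by fun_prop), expect_one]; ring

theorem expect_sin_sq {κ : ℝ} (h : κ ≠ 0) :
    expect κ (fun t => Real.sin t ^ 2) = besselA 1 κ / κ := by
  rw [← mul_expect_sin_sq, mul_div_cancel_left₀ _ h]

theorem varCos_eq {κ : ℝ} (h : κ ≠ 0) :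
    varCos κ = 1 - besselA 1 κ ^ 2 - besselA 1 κ / κ := by
  rw [varCos, expect_cos_sq, expect_sin_sq h]; ring

/-- The influence function `cos φ - κ sin² φ` of the score matching estimator (up to a constant)
is centred. -/
theorem expect_influence (κ : ℝ) :
    expect κ (fun t => Real.cos t - κ * Real.sin t ^ 2) = 0 := by
  have e : (fun t => Real.cos t - κ * Real.sin t ^ 2) =
      fun t => 1 * Real.cos t + (-κ) * Real.sin t ^ 2 := by ext; ring
  rw [e, expect_linear Real.continuous_cos (by fun_prop), ← besselA_one_eq, neg_mul,
    mul_expect_sin_sq]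
  ring

/-- The variance of the influence function, by Stein's identity for `g = sin`, `cos sin` and
`sin³`. -/
theorem expect_influence_sq {κ : ℝ} (h : κ ≠ 0) :
    expect κ (fun t => (Real.cos t - κ * Real.sin t ^ 2) ^ 2) = 2 - 3 * (besselA 1 κ / κ) := by
  have i1 : κ * expect κ (fun t => Real.cos t * Real.sin t ^ 2) =
      expect κ (fun t => 1 * Real.cos t ^ 2 + (-1) * Real.sin t ^ 2) :=
    mul_expect_mul_sin (g := fun t => Real.cos t * Real.sin t)
      (fun t => by
        convert! (Real.hasDerivAt_cos t).mul (Real.hasDerivAt_sin t) using 1; ring)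
      (by fun_prop) (by simp) fun t => by ring
  have i2 : κ * expect κ (fun t => Real.sin t ^ 4) =
      expect κ (fun t => 3 * (Real.cos t * Real.sin t ^ 2) + 0 * 1) :=
    mul_expect_mul_sin (g := fun t => Real.sin t ^ 3)
      (fun t => by convert! (Real.hasDerivAt_sin t).pow 3 using 1; simp; ring)
      (by fun_prop) (by simp) fun t => by ring
  rw [expect_linear (by fun_prop) (by fun_prop), expect_cos_sq, expect_sin_sq h] at i1
  rw [expect_linear (by fun_prop) (by fun_prop)] at i2
  have e : (fun t => (Real.cos t - κ * Real.sin t ^ 2) ^ 2) =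
      fun t => 1 * (1 * Real.cos t ^ 2 + (-2 * κ) * (Real.cos t * Real.sin t ^ 2)) +
        κ ^ 2 * Real.sin t ^ 4 := by ext; ring
  rw [e, expect_linear (by fun_prop) (by fun_prop), expect_linear (by fun_prop) (by fun_prop),
    expect_cos_sq, expect_sin_sq h]
  linear_combination i1 + κ * i2

/-- This makes the asymptotic variance of the score matching estimator positive: it is the variance
of an influence function that does not vanish at `φ = 0`. -/
theorem two_sub_three_mul_pos {κ : ℝ} (h : κ ≠ 0) : 0 < 2 - 3 * (besselA 1 κ / κ) := by
  rw [← expect_influence_sq h]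
  exact expect_pos (by fun_prop) (fun _ => sq_nonneg _) ⟨0, ⟨le_rfl, by positivity⟩, by simp⟩

/-! ### High concentration -/

/-- The Laplace transform of `1 - cos φ` for the uniform angle `φ ∈ (-π, π)`, times `2π`. -/
noncomputable def laplaceOneSubCos (κ : ℝ) : ℝ :=
  ∫ t in (-Real.pi)..Real.pi, Real.exp (-(κ * (1 - Real.cos t)))

theorem expInt_eq_shift {κ : ℝ} {h : ℝ → ℝ} (hp : Function.Periodic h (2 * Real.pi)) :
    expInt κ h = Real.exp κ *
      ∫ t in (-Real.pi)..Real.pi, h t * Real.exp (-(κ * (1 - Real.cos t))) := by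
  have h1 : Function.Periodic (fun t => h t * Real.exp (κ * Real.cos t)) (2 * Real.pi) :=
    fun t => by simp only [hp t, Real.cos_add_two_pi]
  have h2 := h1.intervalIntegral_add_eq 0 (-Real.pi)
  rw [zero_add, show -Real.pi + 2 * Real.pi = Real.pi by ring] at h2
  rw [expInt, h2, ← intervalIntegral.integral_const_mul]
  congr 1; ext t
  rw [show κ * Real.cos t = κ + -(κ * (1 - Real.cos t)) by ring, Real.exp_add]
  ring

/-- Comparison with a Gaussian integral through `1 - cos t ≥ 2 t² / π²`. -/
theorem laplaceOneSubCos_le {κ : ℝ} (h : 0 < κ) :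
    laplaceOneSubCos κ ≤ √(Real.pi ^ 3 / 2) / √κ := by
  have hint : Integrable fun t : ℝ => Real.exp (-(2 * κ / Real.pi ^ 2) * t ^ 2) :=
    integrable_exp_neg_mul_sq (by positivity)
  calc laplaceOneSubCos κ
      ≤ ∫ t in (-Real.pi)..Real.pi, Real.exp (-(2 * κ / Real.pi ^ 2) * t ^ 2) := by
        refine intervalIntegral.integral_mono_on (by linarith [Real.pi_pos])
          (Continuous.intervalIntegrable (by fun_prop) _ _) hint.intervalIntegrable
          fun t ht => Real.exp_le_exp.2 ?_
        have := Real.cos_le_one_sub_mul_cos_sq (abs_le.2 ht)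
        have h3 := mul_le_mul_of_nonneg_left this h.le
        have h4 : 2 * κ / Real.pi ^ 2 * t ^ 2 = κ * (2 / Real.pi ^ 2 * t ^ 2) := by ring
        rw [neg_mul, h4]
        linarith
    _ ≤ ∫ t : ℝ, Real.exp (-(2 * κ / Real.pi ^ 2) * t ^ 2) := by
        rw [intervalIntegral.integral_of_le (by linarith [Real.pi_pos])]
        exact setIntegral_le_integral hint (ae_of_all _ fun _ => (Real.exp_pos _).le)
    _ = √(Real.pi ^ 3 / 2) / √κ := by
        rw [integral_gaussian, ← Real.sqrt_div (by positivity)]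
        congr 1
        field_simp

/-- On `|t| ≤ 1 / √κ` the exponent `κ (1 - cos t)` is at most `1 / 2`. -/
theorem le_laplaceOneSubCos {κ : ℝ} (h : 1 ≤ κ) :
    2 * Real.exp (-(1 / 2)) / √κ ≤ laplaceOneSubCos κ := by
  have hs : 0 < √κ := Real.sqrt_pos.2 (by linarith)
  have hs1 : 1 / √κ ≤ 1 := (div_le_one hs).2 (Real.one_le_sqrt.2 h)
  have hpi := Real.pi_gt_three
  have hpos : 0 < 1 / √κ := by positivity
  calc 2 * Real.exp (-(1 / 2)) / √κ
      = ∫ _ in (-(1 / √κ))..(1 / √κ), Real.exp (-(1 / 2)) := by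
        rw [intervalIntegral.integral_const, smul_eq_mul]; ring
    _ ≤ ∫ t in (-(1 / √κ))..(1 / √κ), Real.exp (-(κ * (1 - Real.cos t))) := by
        refine intervalIntegral.integral_mono_on (by linarith)
          (Continuous.intervalIntegrable (by fun_prop) _ _)
          (Continuous.intervalIntegrable (by fun_prop) _ _) fun t ht => Real.exp_le_exp.2 ?_
        have h1 := Real.one_sub_sq_div_two_le_cos (x := t)
        have h2 : t ^ 2 ≤ 1 / κ := by
          have := sq_le_sq' ht.1 ht.2
          rwa [div_pow, Real.sq_sqrt (by linarith), one_pow] at this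
        have h3 : κ * t ^ 2 ≤ 1 := by
          have := mul_le_mul_of_nonneg_left h2 (by linarith : (0 : ℝ) ≤ κ)
          rwa [mul_one_div_cancel (by linarith)] at this
        nlinarith
    _ ≤ laplaceOneSubCos κ := by
        refine intervalIntegral.integral_mono_interval (by linarith) (by linarith) (by linarith)
          (ae_of_all _ fun _ => (Real.exp_pos _).le)
          (Continuous.intervalIntegrable (by fun_prop) _ _)

/-- The moment of order `j` of `1 - cos φ`. -/
noncomputable def versineMoment (j : ℕ) (κ : ℝ) : ℝ := expect κ fun t => (1 - Real.cos t) ^ j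

/-- As `κ → ∞` the variable `κ (1 - cos φ)` keeps bounded moments: `y ^ j exp (-y)` is at most a
constant times `exp (-y / 2)`, and halving `κ` changes the Laplace transform of `1 - cos φ` by a
bounded factor since it is of exact order `κ ^ (-1/2)`. -/
theorem exists_pow_mul_versineMoment_le (j : ℕ) :
    ∃ C, ∀ κ : ℝ, 1 ≤ κ → κ ^ j * versineMoment j κ ≤ C := by
  refine ⟨2 ^ j * j.factorial * (√(Real.pi ^ 3 / 2) / √(1 / 2)) / (2 * Real.exp (-(1 / 2))),
    fun κ hκ => ?_⟩
  have h0 : 0 < κ := by linarith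
  have hs : 0 < √κ := Real.sqrt_pos.2 h0
  have hlow := le_laplaceOneSubCos hκ
  have hup := laplaceOneSubCos_le (half_pos h0)
  have e1 : expInt κ (fun _ => 1) = Real.exp κ * laplaceOneSubCos κ := by
    rw [expInt_eq_shift (fun _ => rfl), laplaceOneSubCos]; simp
  have e2 : κ ^ j * ∫ t in (-Real.pi)..Real.pi,
      (1 - Real.cos t) ^ j * Real.exp (-(κ * (1 - Real.cos t))) ≤
      2 ^ j * j.factorial * laplaceOneSubCos (κ / 2) := by
    rw [laplaceOneSubCos, ← intervalIntegral.integral_const_mul,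
      ← intervalIntegral.integral_const_mul]
    refine intervalIntegral.integral_mono_on (by linarith [Real.pi_pos])
      (Continuous.intervalIntegrable (by fun_prop) _ _)
      (Continuous.intervalIntegrable (by fun_prop) _ _) fun t _ => ?_
    have hy : 0 ≤ κ / 2 * (1 - Real.cos t) :=
      mul_nonneg (by linarith) (by linarith [Real.cos_le_one t])
    have hp := Real.pow_div_factorial_le_exp _ hy j
    rw [div_le_iff₀ (by positivity), mul_pow, div_pow, div_mul_eq_mul_div,
      div_le_iff₀ (by positivity)] at hp
    have hsplit : Real.exp (-(κ * (1 - Real.cos t))) =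
        Real.exp (-(κ / 2 * (1 - Real.cos t))) * Real.exp (-(κ / 2 * (1 - Real.cos t))) := by
      rw [← Real.exp_add]; congr 1; ring
    have hmul : Real.exp (κ / 2 * (1 - Real.cos t)) *
        Real.exp (-(κ / 2 * (1 - Real.cos t))) = 1 := by
      rw [← Real.exp_add]; simp
    calc κ ^ j * ((1 - Real.cos t) ^ j * Real.exp (-(κ * (1 - Real.cos t))))
        = κ ^ j * (1 - Real.cos t) ^ j * (Real.exp (-(κ / 2 * (1 - Real.cos t))) *
            Real.exp (-(κ / 2 * (1 - Real.cos t)))) := by rw [hsplit]; ring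
      _ ≤ Real.exp (κ / 2 * (1 - Real.cos t)) * j.factorial * 2 ^ j *
          (Real.exp (-(κ / 2 * (1 - Real.cos t))) * Real.exp (-(κ / 2 * (1 - Real.cos t)))) :=
          mul_le_mul_of_nonneg_right hp (by positivity)
      _ = Real.exp (κ / 2 * (1 - Real.cos t)) * Real.exp (-(κ / 2 * (1 - Real.cos t))) *
          (2 ^ j * j.factorial * Real.exp (-(κ / 2 * (1 - Real.cos t)))) := by ring
      _ = _ := by rw [hmul, one_mul]
  have hl0 : 0 < laplaceOneSubCos κ := lt_of_lt_of_le (by positivity) hlow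
  have hper : Function.Periodic (fun t => (1 - Real.cos t) ^ j) (2 * Real.pi) :=
    fun t => by simp only [Real.cos_add_two_pi]
  rw [versineMoment, expect, e1, expInt_eq_shift hper,
    mul_div_mul_left _ _ (Real.exp_pos κ).ne', ← mul_div_assoc]
  have hk : √(κ / 2) = √κ * √(1 / 2) := by rw [← Real.sqrt_mul h0.le]; congr 1; ring
  calc _ ≤ 2 ^ j * j.factorial * (√(Real.pi ^ 3 / 2) / √(κ / 2)) /
        (2 * Real.exp (-(1 / 2)) / √κ) :=
        div_le_div₀ (by positivity) (e2.trans (mul_le_mul_of_nonneg_left hup (by positivity)))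
          (by positivity) hlow
    _ = _ := by rw [hk]; field_simp

theorem tendsto_pow_mul_versineMoment (j : ℕ) :
    Tendsto (fun κ : ℝ => κ ^ j * versineMoment (j + 1) κ) atTop (𝓝 0) := by
  obtain ⟨C, hC⟩ := exists_pow_mul_versineMoment_le (j + 1)
  refine squeeze_zero' (g := fun κ => C / κ) ?_ ?_ (tendsto_const_nhds.div_atTop tendsto_id)
  · filter_upwards [eventually_ge_atTop 1] with κ hκ
    refine mul_nonneg (by positivity) (expect_pos (by fun_prop)
      (fun t => pow_nonneg (by linarith [Real.cos_le_one t]) _)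
      ⟨Real.pi, ⟨Real.pi_pos.le, by linarith [Real.pi_pos]⟩, ?_⟩).le
    rw [Real.cos_pi]; positivity
  · filter_upwards [eventually_ge_atTop 1] with κ hκ
    rw [le_div_iff₀ (by linarith)]
    refine le_trans (le_of_eq ?_) (hC κ hκ)
    ring

/-- Integration by parts relates consecutive moments of `1 - cos φ`. -/
theorem versineMoment_recurrence (j : ℕ) (κ : ℝ) :
    κ * (2 * versineMoment (j + 1) κ - versineMoment (j + 2) κ) =
      (2 * j + 1) * versineMoment j κ - (j + 1) * versineMoment (j + 1) κ := by
  have h := mul_expect_mul_sin (κ := κ)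
    (f := fun t => 2 * (1 - Real.cos t) ^ (j + 1) + (-1) * (1 - Real.cos t) ^ (j + 2))
    (g := fun t => (1 - Real.cos t) ^ j * Real.sin t)
    (g' := fun t => (2 * j + 1) * (1 - Real.cos t) ^ j +
      (-(j + 1 : ℝ)) * (1 - Real.cos t) ^ (j + 1))
    (fun t => by
      have h := (((Real.hasDerivAt_cos t).const_sub 1).pow j).mul (Real.hasDerivAt_sin t)
      convert! h using 1
      have hs : Real.sin t ^ 2 = (1 - Real.cos t) * (2 - (1 - Real.cos t)) := by
        rw [Real.sin_sq]; ring
      rcases j with - | j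
      · simp
      · simp only [Nat.add_sub_cancel, Pi.pow_apply]
        push_cast
        linear_combination (-(j + 1 : ℝ)) * (1 - Real.cos t) ^ j * hs)
    (by fun_prop) (by simp) fun t => by
      have hs : Real.sin t ^ 2 = (1 - Real.cos t) * (2 - (1 - Real.cos t)) := by
        rw [Real.sin_sq]; ring
      linear_combination (-(1 - Real.cos t) ^ j) * hs
  rw [expect_linear (by fun_prop) (by fun_prop), expect_linear (by fun_prop) (by fun_prop)] at h
  simp only [versineMoment]
  linarith

theorem versineMoment_zero (κ : ℝ) : versineMoment 0 κ = 1 := by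
  simp [versineMoment, expect_one]

theorem versineMoment_one (κ : ℝ) : versineMoment 1 κ = 1 - besselA 1 κ := by
  have e : (fun t => (1 - Real.cos t) ^ 1) = fun t => 1 * 1 + (-1) * Real.cos t := by
    ext t; ring
  rw [versineMoment, e, expect_linear continuous_const Real.continuous_cos, expect_one,
    besselA_one_eq]
  ring

theorem tendsto_besselA_atTop : Tendsto (besselA 1) atTop (𝓝 1) := by
  have h := (tendsto_pow_mul_versineMoment 0).const_sub 1
  simp only [pow_zero, one_mul, zero_add, versineMoment_one, sub_sub_cancel, sub_zero] at h
  exact h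

theorem varCos_eq_versineMoment (κ : ℝ) :
    varCos κ = versineMoment 2 κ - versineMoment 1 κ ^ 2 := by
  have h : versineMoment 2 κ = expect κ fun t => (Real.cos t - 1) ^ 2 := by
    rw [versineMoment]; congr 1; ext t; ring
  rw [h, expect_sq_sub Real.continuous_cos, versineMoment_one, ← besselA_one_eq, varCos]
  ring

/-- The second-order behaviour of `A₁` at infinity. Given that `κ E (1 - cos φ)²` and
`κ² E (1 - cos φ)³` vanish in the limit, the recurrence for orders `0` and `1` gives
`κ E (1 - cos φ) → 1 / 2` and `κ² E (1 - cos φ)² → 3 / 4`. -/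
theorem tendsto_sq_mul_varCos : Tendsto (fun κ => κ ^ 2 * varCos κ) atTop (𝓝 (1 / 2)) := by
  have z1 := tendsto_pow_mul_versineMoment 0
  have z2 := tendsto_pow_mul_versineMoment 1
  have z3 := tendsto_pow_mul_versineMoment 2
  have l1 : Tendsto (fun κ : ℝ => κ * versineMoment 1 κ) atTop (𝓝 (1 / 2)) := by
    have h := ((z1.const_sub 1).add z2).div_const 2
    simp only [sub_zero, add_zero] at h
    refine h.congr fun κ => ?_
    have := versineMoment_recurrence 0 κ
    simp only [versineMoment_zero, zero_add, Nat.cast_zero] at this ⊢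
    linear_combination (-1 / 2) * this
  have l2 : Tendsto (fun κ : ℝ => κ ^ 2 * versineMoment 2 κ) atTop (𝓝 (3 / 4)) := by
    have h := (((l1.const_mul 3).sub (z2.const_mul 2)).add z3).div_const 2
    rw [show ((3 * (1 / 2) - 2 * 0 + 0) / 2 : ℝ) = 3 / 4 by norm_num] at h
    refine h.congr fun κ => ?_
    have := versineMoment_recurrence 1 κ
    simp only [Nat.cast_one, Nat.reduceAdd] at this ⊢
    linear_combination (-κ / 2) * this
  have h := l2.sub (l1.pow 2)
  rw [show (3 / 4 - (1 / 2) ^ 2 : ℝ) = 1 / 2 by norm_num] at h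
  refine h.congr fun κ => ?_
  rw [varCos_eq_versineMoment]; ring

/-! ### The asymptotic variances as functions of the concentration -/

theorem varCos_zero : varCos 0 = 1 / 2 := by
  have h : expect 0 (fun t => Real.cos t ^ 2) = 1 / 2 := by
    simp only [expect, expInt, zero_mul, Real.exp_zero, mul_one, integral_cos_sq,
      intervalIntegral.integral_const]
    simp
    field_simp
  rw [varCos, h, besselA_zero]; norm_num

/-- The limit is the derivative of `A₁` at `0`. -/
theorem tendsto_besselA_div_zero :
    Tendsto (fun κ => besselA 1 κ / κ) (𝓝[>] 0) (𝓝 (1 / 2)) := by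
  have h := (hasDerivAt_besselA 0).tendsto_slope
  rw [varCos_zero] at h
  refine (h.mono_left (nhdsWithin_mono _ fun x hx => (ne_of_gt hx : x ≠ 0))).congr fun κ => ?_
  rw [slope_def_field, besselA_zero, sub_zero, sub_zero]

/-- The asymptotic variance of the score matching estimator. -/
noncomputable def varSME (κ : ℝ) : ℝ := κ * (2 * κ - 3 * besselA 1 κ) / besselA 1 κ ^ 2

/-- The asymptotic variance of the maximum likelihood estimator. -/
noncomputable def varMLE (κ : ℝ) : ℝ := 1 / (1 - besselA 1 κ ^ 2 - besselA 1 κ / κ)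

theorem varMLE_eq {κ : ℝ} (h : κ ≠ 0) : varMLE κ = (varCos κ)⁻¹ := by
  rw [varMLE, varCos_eq h, one_div]

theorem varSME_eq {κ : ℝ} (h : 0 < κ) :
    varSME κ = (2 - 3 * (besselA 1 κ / κ)) / (besselA 1 κ / κ) ^ 2 := by
  have := besselA_pos h
  rw [varSME]; field_simp

theorem varSME_pos {κ : ℝ} (h : 0 < κ) : 0 < varSME κ := by
  have := besselA_pos h
  have := two_sub_three_mul_pos h.ne'
  rw [varSME_eq h]; positivity

theorem varMLE_pos {κ : ℝ} (h : κ ≠ 0) : 0 < varMLE κ := by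
  rw [varMLE_eq h]; exact inv_pos.2 (varCos_pos κ)

theorem varMLE_div_varSME {κ : ℝ} (h : 0 < κ) :
    varMLE κ / varSME κ = besselA 1 κ ^ 2 / ((2 * κ - 3 * besselA 1 κ) *
      (κ - κ * besselA 1 κ ^ 2 - besselA 1 κ)) := by
  have hA := (besselA_pos h).ne'
  have h1 := (varCos_pos κ).ne'
  rw [varCos_eq h.ne'] at h1
  have h2 : κ - κ * besselA 1 κ ^ 2 - besselA 1 κ =
      κ * (1 - besselA 1 κ ^ 2 - besselA 1 κ / κ) := by field_simp
  rw [varMLE, varSME, h2, div_div_div_eq, one_mul]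
  congr 1; ring

theorem tendsto_varSME_zero : Tendsto varSME (𝓝[>] 0) (𝓝 2) := by
  have h := ((tendsto_besselA_div_zero.const_mul 3).const_sub 2).div
    (tendsto_besselA_div_zero.pow 2) (by norm_num)
  rw [show ((2 - 3 * (1 / 2)) / (1 / 2) ^ 2 : ℝ) = 2 by norm_num] at h
  refine h.congr' ?_
  filter_upwards [self_mem_nhdsWithin] with κ hκ using (varSME_eq hκ).symm

theorem tendsto_varMLE_zero : Tendsto varMLE (𝓝[>] 0) (𝓝 2) := by
  have h := (continuous_varCos.tendsto 0).inv₀ (varCos_pos 0).ne'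
  rw [varCos_zero, one_div, inv_inv] at h
  refine (h.mono_left nhdsWithin_le_nhds).congr' ?_
  filter_upwards [self_mem_nhdsWithin] with κ hκ using (varMLE_eq (ne_of_gt hκ)).symm

theorem isEquivalent_varSME : Asymptotics.IsEquivalent atTop varSME fun κ => 2 * κ ^ 2 := by
  refine (Asymptotics.isEquivalent_iff_tendsto_one ?_).2 ?_
  · filter_upwards [eventually_gt_atTop 0] with κ hκ using by positivity
  have h := ((((tendsto_besselA_atTop.div_atTop tendsto_id).const_mul 3).const_sub 2).div
    ((tendsto_besselA_atTop.pow 2).const_mul 2) (by norm_num))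
  rw [show ((2 - 3 * 0) / (2 * 1 ^ 2) : ℝ) = 1 by norm_num] at h
  refine h.congr' ?_
  filter_upwards [eventually_gt_atTop 0] with κ hκ
  have := besselA_pos hκ
  simp only [Pi.div_apply, varSME, id]
  field_simp

theorem isEquivalent_varMLE : Asymptotics.IsEquivalent atTop varMLE fun κ => 2 * κ ^ 2 := by
  refine (Asymptotics.isEquivalent_iff_tendsto_one ?_).2 ?_
  · filter_upwards [eventually_gt_atTop 0] with κ hκ using by positivity
  have h := (tendsto_sq_mul_varCos.const_mul 2).inv₀ (by norm_num)
  rw [show ((2 * (1 / 2))⁻¹ : ℝ) = 1 by norm_num] at h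
  refine h.congr' ?_
  filter_upwards [eventually_gt_atTop 0] with κ hκ
  simp only [Pi.div_apply, varMLE_eq hκ.ne']
  rw [mul_inv, mul_inv, div_eq_mul_inv, mul_inv]
  ring

theorem tendsto_varMLE_div_varSME_zero :
    Tendsto (fun κ => varMLE κ / varSME κ) (𝓝[>] 0) (𝓝 1) := by
  have h := tendsto_varMLE_zero.div tendsto_varSME_zero (by norm_num)
  rwa [div_self (two_ne_zero)] at h

theorem tendsto_varMLE_div_varSME_atTop :
    Tendsto (fun κ => varMLE κ / varSME κ) atTop (𝓝 1) := by
  refine (Asymptotics.isEquivalent_iff_tendsto_one ?_).1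
    (isEquivalent_varMLE.trans isEquivalent_varSME.symm)
  filter_upwards [eventually_gt_atTop 0] with κ hκ using (varSME_pos hκ).ne'

end VonMises

/-! ### Slutsky's theorem -/

/-- Convergence in distribution to the constant `0` implies convergence in probability. -/
theorem MeasureTheory.TendstoInDistribution.tendstoInMeasure_zero {Ω Ω' : Type*}
    [MeasurableSpace Ω] [MeasurableSpace Ω'] {P : Measure Ω} [IsProbabilityMeasure P]
    {P' : Measure Ω'} [IsProbabilityMeasure P'] {X : ℕ → Ω → ℝ}
    (h : TendstoInDistribution X atTop (fun _ : Ω' => (0 : ℝ)) (fun _ => P) P') :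
    TendstoInMeasure P X atTop 0 := by
  rw [tendstoInMeasure_iff_norm]
  intro ε hε
  have hF : IsClosed {x : ℝ | ε ≤ ‖x‖} := isClosed_le continuous_const continuous_norm
  have hl := ProbabilityMeasure.limsup_measure_closed_le_of_tendsto h.tendsto hF
  simp only [ProbabilityMeasure.coe_mk] at hl
  rw [Measure.map_apply measurable_const hF.measurableSet] at hl
  have h0 : (fun _ : Ω' => (0 : ℝ)) ⁻¹' {x : ℝ | ε ≤ ‖x‖} = ∅ := by
    ext; simp [hε]
  rw [h0, measure_empty] at hl
  refine tendsto_of_le_liminf_of_limsup_le zero_le (le_trans (le_of_eq ?_) hl)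
  congr 1; ext n
  rw [Measure.map_apply_of_aemeasurable (h.forall_aemeasurable n) hF.measurableSet]
  simp

/-- Slutsky's theorem in the form used for the delta method: a statistic that is eventually
`D * (U + V * E)`, where `U` and `V` converge in distribution while `E → 0` and `D → 1` almost
surely, has the same limit in distribution as `U`. -/
theorem MeasureTheory.TendstoInDistribution.of_eventually_eq_mul_add {Ω Ω₁ Ω₂ : Type*}
    [MeasurableSpace Ω] [MeasurableSpace Ω₁] [MeasurableSpace Ω₂]
    {P : Measure Ω} [IsProbabilityMeasure P] {P₁ : Measure Ω₁} [IsProbabilityMeasure P₁]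
    {P₂ : Measure Ω₂} [IsProbabilityMeasure P₂] {U V E D W : ℕ → Ω → ℝ} {Z₁ : Ω₁ → ℝ}
    {Z₂ : Ω₂ → ℝ}
    (hU : TendstoInDistribution U atTop Z₁ (fun _ => P) P₁)
    (hV : TendstoInDistribution V atTop Z₂ (fun _ => P) P₂)
    (hEm : ∀ n, AEMeasurable (E n) P) (hDm : ∀ n, AEMeasurable (D n) P)
    (hWm : ∀ n, AEMeasurable (W n) P)
    (hE : ∀ᵐ ω ∂P, Tendsto (fun n => E n ω) atTop (𝓝 0))
    (hD : ∀ᵐ ω ∂P, Tendsto (fun n => D n ω) atTop (𝓝 1))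
    (hW : ∀ᵐ ω ∂P, ∀ᶠ n in atTop, W n ω = D n ω * (U n ω + V n ω * E n ω)) :
    TendstoInDistribution W atTop Z₁ (fun _ => P) P₁ := by
  have hE' : TendstoInMeasure P E atTop fun _ => 0 :=
    tendstoInMeasure_of_tendsto_ae (fun n => (hEm n).aestronglyMeasurable) hE
  have hD' : TendstoInMeasure P D atTop fun _ => 1 :=
    tendstoInMeasure_of_tendsto_ae (fun n => (hDm n).aestronglyMeasurable) hD
  have hVE := hV.continuous_comp_prodMk_of_tendstoInMeasure_const
    (g := fun p : ℝ × ℝ => p.1 * p.2) (by fun_prop) hE' hEm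
  simp only [mul_zero] at hVE
  have hVm := hV.forall_aemeasurable
  have hUm := hU.forall_aemeasurable
  have hUVE := hU.continuous_comp_prodMk_of_tendstoInMeasure_const
    (g := fun p : ℝ × ℝ => p.1 + p.2) (c := 0) (by fun_prop) hVE.tendstoInMeasure_zero
    fun n => (hVm n).mul (hEm n)
  have hDU := hUVE.continuous_comp_prodMk_of_tendstoInMeasure_const
    (g := fun p : ℝ × ℝ => p.2 * p.1) (by fun_prop) hD' hDm
  simp only [one_mul, add_zero] at hDU
  refine tendstoInDistribution_of_tendstoInMeasure_sub W Z₁ hDU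
    (tendstoInMeasure_of_tendsto_ae (fun n => ((hWm n).sub
      (hDU.forall_aemeasurable n)).aestronglyMeasurable) ?_) hWm
  filter_upwards [hW] with ω hω
  refine tendsto_const_nhds.congr' ?_
  filter_upwards [hω] with n hn
  simp [hn]

namespace VonMises

/-! ### Limit theorems for von Mises samples -/

theorem measurable_density (θ₀ κ : ℝ) : Measurable (density θ₀ κ) := by
  unfold density; fun_prop

theorem density_pos (θ₀ κ θ : ℝ) : 0 < density θ₀ κ θ := by
  rw [density, two_pi_mul_besselI_zero]
  exact div_pos (Real.exp_pos _) (expInt_one_pos κ)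

theorem law_absolutelyContinuous (θ₀ κ : ℝ) : law θ₀ κ ≪ volume :=
  (withDensity_absolutelyContinuous _ _).trans Measure.absolutelyContinuous_restrict

/-- A `2π`-periodic function of the angle measured from `θ₀` has the expectation it would have
under the von Mises distribution of orientation `0`. -/
theorem integral_law (θ₀ κ : ℝ) {f : ℝ → ℝ} (hp : Function.Periodic f (2 * Real.pi)) :
    ∫ θ, f (θ - θ₀) ∂law θ₀ κ = expect κ f := by
  rw [law, integral_withDensity_eq_integral_toReal_smul
    (measurable_density θ₀ κ).ennreal_ofReal (ae_of_all _ fun _ => ENNReal.ofReal_lt_top)]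
  have e : ∀ θ, (ENNReal.ofReal (density θ₀ κ θ)).toReal • f (θ - θ₀) =
      (fun t => f t * Real.exp (κ * Real.cos t)) (θ - θ₀) / expInt κ fun _ => 1 := fun θ => by
    rw [ENNReal.toReal_ofReal (density_pos _ _ _).le, smul_eq_mul, density,
      two_pi_mul_besselI_zero]
    ring
  simp only [e]
  have h1 : Function.Periodic (fun t => f t * Real.exp (κ * Real.cos t)) (2 * Real.pi) :=
    fun t => by simp only [hp t, Real.cos_add_two_pi]
  have h2 := h1.intervalIntegral_add_eq 0 (-θ₀)
  rw [integral_div, ← integral_Icc_eq_integral_Ico, integral_Icc_eq_integral_Ioc,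
    ← intervalIntegral.integral_of_le (by positivity), intervalIntegral.integral_comp_sub_right
      (fun t => f t * Real.exp (κ * Real.cos t)), zero_sub, sub_eq_neg_add, ← h2, zero_add]
  rfl

/-- The sample mean of `f` at the angles measured from `θ₀`. -/
noncomputable def sampleMean {Ω : Type*} (X : ℕ → Ω → ℝ) (θ₀ : ℝ) (f : ℝ → ℝ) (n : ℕ) (ω : Ω) : ℝ :=
  (n : ℝ)⁻¹ * ∑ i ∈ Finset.range n, f (X i ω - θ₀)

section Sample

variable {Ω : Type*} [MeasurableSpace Ω] {P : Measure Ω} {θ₀ κ : ℝ} {X : ℕ → Ω → ℝ}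

theorem aemeasurable_sampleMean (hlaw : ∀ i, HasLaw (X i) (law θ₀ κ) P) {f : ℝ → ℝ}
    (hf : Measurable f) (n : ℕ) : AEMeasurable (sampleMean X θ₀ f n) P := by
  have := fun i => (hlaw i).aemeasurable
  unfold sampleMean
  refine AEMeasurable.const_mul (Finset.aemeasurable_fun_sum _ fun i _ => ?_) _
  exact hf.comp_aemeasurable ((this i).sub_const _)

theorem integral_comp_sub (hlaw : ∀ i, HasLaw (X i) (law θ₀ κ) P) {f : ℝ → ℝ}
    (hf : Measurable f) (hp : Function.Periodic f (2 * Real.pi)) (i : ℕ) :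
    ∫ ω, f (X i ω - θ₀) ∂P = expect κ f := by
  rw [← integral_law θ₀ κ hp]
  exact (hlaw i).integral_comp (f := fun θ => f (θ - θ₀))
    (by fun_prop : Measurable fun θ => f (θ - θ₀)).aestronglyMeasurable

theorem identDistrib_comp_sub (hlaw : ∀ i, HasLaw (X i) (law θ₀ κ) P) {f : ℝ → ℝ}
    (hf : Measurable f) (i : ℕ) :
    IdentDistrib (fun ω => f (X i ω - θ₀)) (fun ω => f (X 0 ω - θ₀)) P P :=
  ((hlaw i).identDistrib (hlaw 0)).comp (by fun_prop : Measurable fun θ => f (θ - θ₀))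

theorem iIndepFun_comp_sub (hX : iIndepFun X P) {f : ℝ → ℝ} (hf : Measurable f) :
    iIndepFun (fun i ω => f (X i ω - θ₀)) P :=
  hX.comp (fun _ θ => f (θ - θ₀)) fun _ => by fun_prop

variable [IsProbabilityMeasure P]

theorem memLp_comp_sub (hlaw : ∀ i, HasLaw (X i) (law θ₀ κ) P) {f : ℝ → ℝ}
    (hf : Continuous f) (hp : Function.Periodic f (2 * Real.pi)) (i : ℕ) (p : ENNReal) :
    MemLp (fun ω => f (X i ω - θ₀)) p P := by
  obtain ⟨C, hC⟩ := isBounded_iff_forall_norm_le.1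
    (hp.isBounded_of_continuous Real.two_pi_pos.ne' hf)
  have := (hlaw i).aemeasurable
  exact MemLp.of_bound (hf.measurable.comp_aemeasurable (this.sub_const _)).aestronglyMeasurable C
    (ae_of_all _ fun ω => hC _ ⟨_, rfl⟩)

/-- Strong law of large numbers for a periodic function of the angles. -/
theorem tendsto_sampleMean (hX : iIndepFun X P) (hlaw : ∀ i, HasLaw (X i) (law θ₀ κ) P)
    {f : ℝ → ℝ} (hf : Continuous f) (hp : Function.Periodic f (2 * Real.pi)) :
    ∀ᵐ ω ∂P, Tendsto (fun n => sampleMean X θ₀ f n ω) atTop (𝓝 (expect κ f)) := by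
  have h := strong_law_ae (fun i ω => f (X i ω - θ₀))
    ((memLp_comp_sub hlaw hf hp 0 1).integrable le_rfl)
    (fun i j hij => (iIndepFun_comp_sub hX hf.measurable).indepFun hij)
    (identDistrib_comp_sub hlaw hf.measurable)
  simp only [integral_comp_sub hlaw hf.measurable hp, smul_eq_mul] at h
  exact h

/-- Central limit theorem for a centred periodic function of the angles. -/
theorem tendstoInDistribution_sampleMean (hX : iIndepFun X P)
    (hlaw : ∀ i, HasLaw (X i) (law θ₀ κ) P) {f : ℝ → ℝ} (hf : Continuous f)
    (hp : Function.Periodic f (2 * Real.pi)) (h0 : expect κ f = 0) :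
    TendstoInDistribution (fun (n : ℕ) ω => √n * sampleMean X θ₀ f n ω) atTop (id : ℝ → ℝ)
      (fun _ => P) (gaussianReal 0 (expect κ fun t => f t ^ 2).toNNReal) := by
  have hvar : Var[fun ω => f (X 0 ω - θ₀); P] = expect κ fun t => f t ^ 2 := by
    rw [variance_of_integral_eq_zero (memLp_comp_sub hlaw hf hp 0 1).aemeasurable
      (by rw [integral_comp_sub hlaw hf.measurable hp, h0])]
    exact integral_comp_sub (f := fun t => f t ^ 2) hlaw (by fun_prop)
      (fun t => by simp only [hp t]) 0
  have h := tendstoInDistribution_inv_sqrt_mul_sum_sub (X := fun i ω => f (X i ω - θ₀))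
    (Y := (id : ℝ → ℝ)) (P' := gaussianReal 0 (expect κ fun t => f t ^ 2).toNNReal)
    (by rw [hvar]; exact HasLaw.id) (memLp_comp_sub hlaw hf hp 0 2)
    (iIndepFun_comp_sub hX hf.measurable) (identDistrib_comp_sub hlaw hf.measurable)
  refine h.congr (fun n => ae_of_all _ fun ω => ?_) (ae_of_all _ fun _ => rfl)
  simp only [integral_comp_sub hlaw hf.measurable hp, h0, mul_zero, sub_zero, sampleMean]
  rw [← mul_assoc, ← div_eq_mul_inv, Real.sqrt_div_self', one_div]

/-- Two independent von Mises angles almost surely do not differ by a multiple of `π`. -/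
theorem ae_sin_sub_ne_zero (hX : iIndepFun X P) (hlaw : ∀ i, HasLaw (X i) (law θ₀ κ) P) :
    ∀ᵐ ω ∂P, Real.sin (X 0 ω - X 1 ω) ≠ 0 := by
  have : IsProbabilityMeasure (law θ₀ κ) := (hlaw 0).isProbabilityMeasure_iff.1 inferInstance
  have hpair := (hX.indepFun zero_ne_one).hasLaw_prod (hlaw 0) (hlaw 1)
  have hm : MeasurableSet {p : ℝ × ℝ | Real.sin (p.1 - p.2) ≠ 0} :=
    (measurableSet_singleton 0).compl.preimage
      (by fun_prop : Measurable fun p : ℝ × ℝ => Real.sin (p.1 - p.2))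
  -- For fixed `x` the exceptional `y` form a countable set, and the law has a density.
  refine (hpair.ae_iff (p := fun p => Real.sin (p.1 - p.2) ≠ 0) ?_).2 ?_
  · exact measurableSet_setOfPred.1 hm
  · refine (Measure.ae_prod_iff_ae_ae hm).2 (ae_of_all _ fun x =>
      (law_absolutelyContinuous θ₀ κ).ae_le ?_)
    refine measure_mono_null (t := Set.range fun k : ℤ => x - k * Real.pi) (fun y hy => ?_)
      ((Set.countable_range _).measure_zero _)
    obtain ⟨k, hk⟩ := Real.sin_eq_zero_iff.1 (not_not.1 hy)
    exact ⟨k, by simp only [hk]; ring⟩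

end Sample

/-! ### The two estimators of a fixed sample -/

/-- The mean resultant length `|n⁻¹ ∑ exp (i θ_h)|`. -/
noncomputable def meanResultant {n : ℕ} (θ : Fin n → ℝ) : ℝ :=
  (n : ℝ)⁻¹ * ‖∑ h, Complex.exp (θ h * Complex.I)‖

/-- The mean of `sin²` of the angles measured from the estimated orientation. -/
noncomputable def meanSinSq {n : ℕ} (θ : Fin n → ℝ) : ℝ :=
  (n : ℝ)⁻¹ * ∑ h, Real.sin (standardize θ h) ^ 2

section Estimators

variable {n : ℕ} (θ : Fin n → ℝ)

theorem measurable_meanResultant : Measurable fun θ : Fin n → ℝ => meanResultant θ := by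
  unfold meanResultant; fun_prop

theorem measurable_meanSinSq : Measurable fun θ : Fin n → ℝ => meanSinSq θ := by
  have : Measurable fun θ : Fin n → ℝ => meanDirection θ :=
    Complex.measurable_arg.comp (by fun_prop)
  unfold meanSinSq standardize
  fun_prop

theorem meanResultant_nonneg : 0 ≤ meanResultant θ := by unfold meanResultant; positivity

theorem exp_sub_mul_I (m : ℝ) :
    ∑ h, Complex.exp ((θ h - m : ℝ) * Complex.I) =
      Complex.exp (-(m * Complex.I)) * ∑ h, Complex.exp (θ h * Complex.I) := by
  rw [Finset.mul_sum]
  refine Finset.sum_congr rfl fun h _ => ?_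
  rw [← Complex.exp_add]
  congr 1; push_cast; ring

theorem sum_cos_sub (m : ℝ) : ∑ h, Real.cos (θ h - m) =
    (Complex.exp (-(m * Complex.I)) * ∑ h, Complex.exp (θ h * Complex.I)).re := by
  rw [← exp_sub_mul_I, Complex.re_sum]
  exact Finset.sum_congr rfl fun h _ => (Complex.exp_ofReal_mul_I_re _).symm

theorem sum_cos_sub_le (m : ℝ) :
    ∑ h, Real.cos (θ h - m) ≤ ‖∑ h, Complex.exp (θ h * Complex.I)‖ := by
  rw [sum_cos_sub]
  refine (Complex.re_le_norm _).trans (le_of_eq ?_)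
  rw [norm_mul, Complex.norm_exp]
  simp

theorem exp_neg_mul_eq_norm_mul_exp (z : ℂ) (m : ℝ) : Complex.exp (-(m * Complex.I)) * z =
    ‖z‖ * Complex.exp ((z.arg - m : ℝ) * Complex.I) := by
  conv_lhs => rw [← Complex.norm_mul_exp_arg_mul_I z]
  rw [mul_left_comm, ← Complex.exp_add]
  congr 2; push_cast; ring

/-- The estimated orientation attains the bound in `sum_cos_sub_le`. If the resultant vanishes, the
value `arg 0 = 0` does no harm since both sides are `0`. -/
theorem sum_cos_standardize :
    ∑ h, Real.cos (standardize θ h) = ‖∑ h, Complex.exp (θ h * Complex.I)‖ := by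
  simp only [standardize]
  rw [sum_cos_sub, exp_neg_mul_eq_norm_mul_exp, meanDirection]
  simp

theorem inv_mul_sum_cos_standardize :
    (n : ℝ)⁻¹ * ∑ h, Real.cos (standardize θ h) = meanResultant θ := by
  rw [sum_cos_standardize, meanResultant]

theorem meanSinSq_nonneg : 0 ≤ meanSinSq θ :=
  mul_nonneg (by positivity) (Finset.sum_nonneg fun _ _ => sq_nonneg _)

theorem deriv_log_density (k : ℝ) :
    deriv (fun x => Real.log (density 0 k x)) = fun x => -(k * Real.sin x) := by
  ext x
  have e : (fun x => Real.log (density 0 k x)) =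
      fun x => k * Real.cos x - Real.log (expInt k fun _ => 1) := by
    ext x
    rw [density, two_pi_mul_besselI_zero, Real.log_div (Real.exp_pos _).ne'
      (expInt_one_pos k).ne', Real.log_exp, sub_zero]
  rw [e]
  have := ((Real.hasDerivAt_cos x).const_mul k).sub_const (Real.log (expInt k fun _ => 1))
  rw [this.deriv]; ring

/-- The score matching criterion is a quadratic polynomial in the concentration. -/
theorem scoreCriterion_standardize (k : ℝ) :
    scoreCriterion (density 0 k) (standardize θ) =
      k ^ 2 / 2 * meanSinSq θ - k * meanResultant θ := by
  have d2 : deriv (fun x => -(k * Real.sin x)) = fun x => -(k * Real.cos x) := by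
    ext x; exact ((Real.hasDerivAt_sin x).const_mul k).neg.deriv
  simp only [scoreCriterion, deriv_log_density, d2]
  rw [← inv_mul_sum_cos_standardize, meanSinSq, mul_left_comm, mul_left_comm k, ← mul_sub,
    Finset.mul_sum (f := fun h => Real.sin (standardize θ h) ^ 2),
    Finset.mul_sum (f := fun h => Real.cos (standardize θ h)), ← Finset.sum_sub_distrib]
  congr 1
  exact Finset.sum_congr rfl fun h _ => by ring

variable {θ}

theorem isHybridSME_iff (ha : meanSinSq θ ≠ 0) {k : ℝ} :
    IsHybridSME θ k ↔ k = meanResultant θ / meanSinSq θ := by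
  have ha' : 0 < meanSinSq θ := lt_of_le_of_ne (meanSinSq_nonneg θ) ha.symm
  simp only [IsHybridSME, scoreCriterion_standardize]
  rw [eq_div_iff ha]
  constructor
  · intro h
    have h1 := h (meanResultant θ / meanSinSq θ)
    have h2 : (k * meanSinSq θ - meanResultant θ) ^ 2 ≤ 0 := by
      have h3 := mul_le_mul_of_nonneg_left h1 ha'.le
      have h4 : meanSinSq θ * ((meanResultant θ / meanSinSq θ) ^ 2 / 2 * meanSinSq θ -
          meanResultant θ / meanSinSq θ * meanResultant θ) = -(meanResultant θ ^ 2 / 2) := by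
        field_simp; ring
      rw [h4] at h3
      nlinarith
    exact sub_eq_zero.1 (pow_eq_zero_iff two_ne_zero |>.1 (le_antisymm h2 (sq_nonneg _)))
  · intro h k'
    rw [← h]
    nlinarith [mul_nonneg ha'.le (sq_nonneg (k' - k))]

theorem not_isHybridSME (ha : meanSinSq θ = 0) (hr : meanResultant θ ≠ 0) (k : ℝ) :
    ¬ IsHybridSME θ k := by
  have hr' : 0 < meanResultant θ := lt_of_le_of_ne (meanResultant_nonneg θ) hr.symm
  intro h
  have := h (k + 1)
  simp only [scoreCriterion_standardize, ha] at this
  linarith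

/-- If the quadratic coefficient `meanSinSq θ` of the criterion vanishes and the linear one does
not, there is no minimizer, and the right-hand side has the same value `0` by division by zero. -/
theorem hybridSME_eq (h : meanSinSq θ ≠ 0 ∨ meanResultant θ ≠ 0) :
    hybridSME θ = meanResultant θ / meanSinSq θ := by
  by_cases ha : meanSinSq θ = 0
  · have hr : meanResultant θ ≠ 0 := by tauto
    rw [hybridSME, dif_neg (fun ⟨k, hk⟩ => not_isHybridSME ha hr k hk), ha, div_zero]
  · have he : ∃ k, IsHybridSME θ k := ⟨_, (isHybridSME_iff ha).2 rfl⟩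
    rw [hybridSME, dif_pos he]
    exact (isHybridSME_iff ha).1 he.choose_spec

/-- `n⁻¹` times the logarithm of the likelihood maximized over the orientation, as a function of
the concentration `k`, when the mean resultant length is `r`. -/
noncomputable def profile (r k : ℝ) : ℝ := k * r - Real.log (expInt k fun _ => 1)

theorem hasDerivAt_profile (r k : ℝ) : HasDerivAt (profile r) (r - besselA 1 k) k := by
  have h := ((hasDerivAt_id k).mul_const r).sub
    ((hasDerivAt_expInt (continuous_const (y := (1 : ℝ))) k).log (expInt_one_pos k).ne')
  convert! h using 1
  rw [besselA_one_eq, expect]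
  simp

theorem exists_profile_sub {r k k' : ℝ} (h : k < k') :
    ∃ x ∈ Set.Ioo k k', profile r k' - profile r k = (r - besselA 1 x) * (k' - k) := by
  obtain ⟨x, hx, hx'⟩ := exists_hasDerivAt_eq_slope (profile r) (fun k => r - besselA 1 k) h
    (fun x _ => (hasDerivAt_profile r x).continuousAt.continuousWithinAt)
    fun x _ => hasDerivAt_profile r x
  exact ⟨x, hx, by rw [hx', div_mul_cancel₀ _ (sub_pos.2 h).ne']⟩

theorem profile_lt {r k k' : ℝ} (hk : besselA 1 k = r) (h : k' ≠ k) :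
    profile r k' < profile r k := by
  rcases lt_or_gt_of_ne h with h | h
  · obtain ⟨x, hx, e⟩ := exists_profile_sub (r := r) h
    have := mul_pos (sub_pos.2 (hk ▸ strictMono_besselA hx.2)) (sub_pos.2 h)
    linarith
  · obtain ⟨x, hx, e⟩ := exists_profile_sub (r := r) h
    have := mul_neg_of_neg_of_pos (sub_neg.2 (hk ▸ strictMono_besselA hx.1)) (sub_pos.2 h)
    linarith

theorem exists_besselA_eq {r : ℝ} (h0 : 0 ≤ r) (h1 : r < 1) : ∃ k, besselA 1 k = r := by
  obtain ⟨b, hb⟩ := (tendsto_besselA_atTop.eventually (eventually_ge_nhds h1)).exists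
  exact mem_range_of_exists_le_of_exists_ge continuous_besselA
    ⟨0, by rwa [besselA_zero]⟩ ⟨b, hb⟩

/-- For `r < 1` the critical point `A₁ k = r` exists and is the strict global maximum; for
`r ≥ 1` the profile is strictly increasing, and `A₁ k = r` has no solution. -/
theorem profile_isMax_iff {r k : ℝ} (hr : 0 ≤ r) :
    (0 ≤ k ∧ ∀ k', 0 ≤ k' → profile r k' ≤ profile r k) ↔ besselA 1 k = r := by
  have nonneg : ∀ {k}, besselA 1 k = r → 0 ≤ k := fun {k} hk =>
    strictMono_besselA.le_iff_le.1 (by rwa [besselA_zero, hk])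
  refine ⟨fun ⟨hk, hmax⟩ => ?_, fun hk => ⟨nonneg hk, fun k' _ => ?_⟩⟩
  · rcases lt_or_ge r 1 with h1 | h1
    · obtain ⟨k₀, hk₀⟩ := exists_besselA_eq hr h1
      by_cases h : k = k₀
      · rw [h, hk₀]
      · exact absurd (hmax k₀ (nonneg hk₀)) (not_le.2 (profile_lt hk₀ h))
    · obtain ⟨x, hx, e⟩ := exists_profile_sub (r := r) (lt_add_one k)
      have := hmax (k + 1) (by linarith)
      have := besselA_lt_one x
      linarith
  · by_cases h : k' = k
    · rw [h]
    · exact (profile_lt hk h).le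

theorem likelihood_eq (hn : n ≠ 0) (m k : ℝ) : likelihood θ m k =
    Real.exp (n * profile ((n : ℝ)⁻¹ * ∑ h, Real.cos (θ h - m)) k) := by
  have hn' : (n : ℝ) ≠ 0 := Nat.cast_ne_zero.2 hn
  have e : (n : ℝ) * profile ((n : ℝ)⁻¹ * ∑ h, Real.cos (θ h - m)) k =
      ∑ h, (k * Real.cos (θ h - m) - Real.log (expInt k fun _ => 1)) := by
    rw [Finset.sum_sub_distrib, ← Finset.mul_sum, Finset.sum_const, Finset.card_univ,
      Fintype.card_fin, nsmul_eq_mul, profile]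
    field_simp
  rw [e, Real.exp_sum]
  refine Finset.prod_congr rfl fun h _ => ?_
  rw [density, two_pi_mul_besselI_zero, Real.exp_sub, Real.exp_log (expInt_one_pos k)]

/-- Since `k ≥ 0`, the likelihood is maximal in the orientation at the mean direction. A vanishing
resultant leaves the orientation undetermined, but the concentration is still `0`. -/
theorem isConcentrationMLE_iff (hn : n ≠ 0) {k : ℝ} :
    IsConcentrationMLE θ k ↔ besselA 1 k = meanResultant θ := by
  have hn' : (0 : ℝ) < n := Nat.cast_pos.2 (Nat.pos_of_ne_zero hn)
  have hC : ∀ m, (n : ℝ)⁻¹ * ∑ h, Real.cos (θ h - m) ≤ meanResultant θ := fun m =>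
    mul_le_mul_of_nonneg_left (sum_cos_sub_le θ m) (by positivity)
  have hC' := inv_mul_sum_cos_standardize θ
  simp only [standardize] at hC'
  have hmono : ∀ {m k'}, 0 ≤ k' →
      profile ((n : ℝ)⁻¹ * ∑ h, Real.cos (θ h - m)) k' ≤ profile (meanResultant θ) k' :=
    fun {m k'} hk' => sub_le_sub_right (mul_le_mul_of_nonneg_left (hC m) hk') _
  rw [← profile_isMax_iff (meanResultant_nonneg θ)]
  simp only [IsConcentrationMLE, IsMLE, likelihood_eq hn, Real.exp_le_exp,
    mul_le_mul_iff_right₀ hn']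
  constructor
  · rintro ⟨m, hk, h⟩
    refine ⟨hk, fun k' hk' => ?_⟩
    have := h (meanDirection θ) k' hk'
    rw [hC'] at this
    exact this.trans (hmono hk)
  · rintro ⟨hk, h⟩
    refine ⟨meanDirection θ, hk, fun m' k' hk' => ?_⟩
    rw [hC']
    exact (hmono hk').trans (h k' hk')

/-- The inverse function of `A₁`, with value `0` outside the range of `A₁`. -/
noncomputable def besselAInv : ℝ → ℝ := Function.extend (besselA 1) id 0

theorem besselAInv_besselA (k : ℝ) : besselAInv (besselA 1 k) = k :=
  strictMono_besselA.injective.extend_apply _ _ _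

theorem measurable_besselAInv : Measurable besselAInv :=
  (continuous_besselA.measurableEmbedding strictMono_besselA.injective).measurable_extend
    measurable_id measurable_const

theorem hasDerivAt_besselAInv (k : ℝ) : HasDerivAt besselAInv (varCos k)⁻¹ (besselA 1 k) :=
  ((hasStrictDerivAt_besselA k).to_local_left_inverse (varCos_pos k).ne'
    (Eventually.of_forall besselAInv_besselA)).hasDerivAt

/-- Both sides are `0` when the mean resultant length is `1`, where no maximizer exists. -/
theorem concentrationMLE_eq (hn : n ≠ 0) : concentrationMLE θ = besselAInv (meanResultant θ) := by
  by_cases he : ∃ k, IsConcentrationMLE θ k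
  · rw [concentrationMLE, dif_pos he, ← (isConcentrationMLE_iff hn).1 he.choose_spec,
      besselAInv_besselA]
  · rw [concentrationMLE, dif_neg he, besselAInv, Function.extend_apply']
    · rfl
    · exact fun ⟨k, hk⟩ => he ⟨k, (isConcentrationMLE_iff hn).2 hk⟩

theorem sin_standardize_sub (i j : Fin n) :
    Real.sin (standardize θ i - standardize θ j) = Real.sin (θ i - θ j) := by
  simp [standardize]

/-- If all `sin φ_h` vanish, any two angles differ by a multiple of `π`. -/
theorem meanSinSq_ne_zero {i j : Fin n} (h : Real.sin (θ i - θ j) ≠ 0) : meanSinSq θ ≠ 0 := by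
  have hn : (n : ℝ) ≠ 0 := Nat.cast_ne_zero.2 i.pos.ne'
  intro h0
  have h1 := (mul_eq_zero.1 h0).resolve_left (inv_ne_zero hn)
  have h2 := fun l => pow_eq_zero_iff two_ne_zero |>.1
    ((Finset.sum_eq_zero_iff_of_nonneg fun _ _ => sq_nonneg _).1 h1 l (Finset.mem_univ l))
  rw [← sin_standardize_sub, Real.sin_sub, h2, h2] at h
  simp at h

/-- A mean resultant length `1` forces every `cos φ_h` to be `1`, hence every `sin φ_h` to be
`0`. -/
theorem meanResultant_lt_one {i j : Fin n} (h : Real.sin (θ i - θ j) ≠ 0) :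
    meanResultant θ < 1 := by
  have hn : (0 : ℝ) < n := Nat.cast_pos.2 i.pos
  rw [← inv_mul_sum_cos_standardize, inv_mul_lt_iff₀ hn, mul_one]
  have hlt : ∃ l, Real.cos (standardize θ l) < 1 := by
    by_contra! hc
    have hs : ∀ l, Real.sin (standardize θ l) = 0 := fun l => by
      have h1 := le_antisymm (Real.cos_le_one _) (hc l)
      have h2 := Real.sin_sq_add_cos_sq (standardize θ l)
      rw [h1] at h2
      exact pow_eq_zero_iff two_ne_zero |>.1 (by linarith)
    rw [← sin_standardize_sub, Real.sin_sub, hs, hs] at h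
    simp at h
  obtain ⟨l, hl⟩ := hlt
  have := Finset.sum_lt_sum (s := Finset.univ) (g := fun _ : Fin n => (1 : ℝ))
    (fun l _ => Real.cos_le_one (standardize θ l)) ⟨l, Finset.mem_univ l, hl⟩
  simpa using this

variable (θ)

/-- Cosine and sine of the error of the estimated orientation. -/
theorem meanResultant_mul_exp (θ₀ : ℝ) :
    (meanResultant θ * Real.cos (meanDirection θ - θ₀) = (n : ℝ)⁻¹ * ∑ h, Real.cos (θ h - θ₀)) ∧
    (meanResultant θ * Real.sin (meanDirection θ - θ₀) = (n : ℝ)⁻¹ * ∑ h, Real.sin (θ h - θ₀)) := by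
  have h2 : (‖∑ h, Complex.exp (θ h * Complex.I)‖ : ℂ) *
      Complex.exp ((meanDirection θ - θ₀ : ℝ) * Complex.I) =
      ∑ h, Complex.exp ((θ h - θ₀ : ℝ) * Complex.I) := by
    rw [exp_sub_mul_I, exp_neg_mul_eq_norm_mul_exp, meanDirection]
  have hre := congrArg Complex.re h2
  have him := congrArg Complex.im h2
  rw [Complex.re_ofReal_mul, Complex.re_sum, Complex.exp_ofReal_mul_I_re] at hre
  rw [Complex.im_ofReal_mul, Complex.im_sum, Complex.exp_ofReal_mul_I_im] at him
  simp only [Complex.exp_ofReal_mul_I_re] at hre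
  simp only [Complex.exp_ofReal_mul_I_im] at him
  rw [meanResultant, mul_assoc, mul_assoc, hre, him]
  exact ⟨rfl, rfl⟩

theorem meanResultant_sq (θ₀ : ℝ) : meanResultant θ ^ 2 =
    ((n : ℝ)⁻¹ * ∑ h, Real.cos (θ h - θ₀)) ^ 2 + ((n : ℝ)⁻¹ * ∑ h, Real.sin (θ h - θ₀)) ^ 2 := by
  obtain ⟨hc, hs⟩ := meanResultant_mul_exp θ θ₀
  rw [← hc, ← hs]
  linear_combination (-meanResultant θ ^ 2) * Real.sin_sq_add_cos_sq (meanDirection θ - θ₀)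

/-- The second moments of the standardized data, obtained from those of the data measured from `θ₀`
by the rotation with cosine `c / r` and sine `s / r`, where `r` is the mean resultant length. -/
theorem meanResultant_sq_mul_meanSinSq (hn : n ≠ 0) (θ₀ : ℝ) :
    let c := (n : ℝ)⁻¹ * ∑ h, Real.cos (θ h - θ₀)
    let s := (n : ℝ)⁻¹ * ∑ h, Real.sin (θ h - θ₀)
    let q := (n : ℝ)⁻¹ * ∑ h, Real.sin (θ h - θ₀) ^ 2
    let p := (n : ℝ)⁻¹ * ∑ h, Real.sin (θ h - θ₀) * Real.cos (θ h - θ₀)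
    meanResultant θ ^ 2 * meanSinSq θ = c ^ 2 * q - 2 * c * s * p + s ^ 2 * (1 - q) := by
  intro c s q p
  obtain ⟨hc, hs⟩ := meanResultant_mul_exp θ θ₀
  have hn' : (n : ℝ) ≠ 0 := Nat.cast_ne_zero.2 hn
  have hq : 1 - q = (n : ℝ)⁻¹ * ∑ h, Real.cos (θ h - θ₀) ^ 2 := by
    simp only [q, Real.cos_sq', Finset.sum_sub_distrib, Finset.sum_const, Finset.card_univ,
      Fintype.card_fin, nsmul_eq_mul, mul_one]
    field_simp
  have ht : ∀ h, meanResultant θ ^ 2 * Real.sin (standardize θ h) ^ 2 =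
      c ^ 2 * Real.sin (θ h - θ₀) ^ 2 - 2 * c * s * (Real.sin (θ h - θ₀) * Real.cos (θ h - θ₀)) +
        s ^ 2 * Real.cos (θ h - θ₀) ^ 2 := fun h => by
    rw [standardize, show θ h - meanDirection θ = (θ h - θ₀) - (meanDirection θ - θ₀) by ring,
      Real.sin_sub]
    simp only [c, s, ← hc, ← hs]
    ring
  rw [hq, meanSinSq, mul_left_comm, Finset.mul_sum, Finset.sum_congr rfl fun h _ => ht h,
    Finset.sum_add_distrib, Finset.sum_sub_distrib, ← Finset.mul_sum, ← Finset.mul_sum,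
    ← Finset.mul_sum]
  simp only [q, p]
  ring

end Estimators

/-! ### Existence, uniqueness and asymptotic normality of the estimators -/

section Sample

variable {Ω : Type*} {θ₀ κ : ℝ} {X : ℕ → Ω → ℝ}

theorem inv_mul_sum_sample (f : ℝ → ℝ) (n : ℕ) (ω : Ω) :
    (n : ℝ)⁻¹ * ∑ h, f (sample X n ω h - θ₀) = sampleMean X θ₀ f n ω := by
  rw [sampleMean, Finset.sum_range]; rfl

theorem sampleMean_linear (f g : ℝ → ℝ) (a b : ℝ) (n : ℕ) (ω : Ω) :
    sampleMean X θ₀ (fun t => a * f t + b * g t) n ω =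
      a * sampleMean X θ₀ f n ω + b * sampleMean X θ₀ g n ω := by
  simp only [sampleMean, Finset.sum_add_distrib, ← Finset.mul_sum]; ring

theorem sampleMean_const (a : ℝ) {n : ℕ} (hn : n ≠ 0) (ω : Ω) :
    sampleMean X θ₀ (fun _ => a) n ω = a := by
  have : (n : ℝ) ≠ 0 := Nat.cast_ne_zero.2 hn
  simp [sampleMean, this]

theorem meanResultant_sample_sq (n : ℕ) (ω : Ω) : meanResultant (sample X n ω) ^ 2 =
    sampleMean X θ₀ Real.cos n ω ^ 2 + sampleMean X θ₀ Real.sin n ω ^ 2 := by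
  rw [meanResultant_sq _ θ₀, inv_mul_sum_sample, inv_mul_sum_sample]

theorem meanResultant_sample_sq_mul {n : ℕ} (hn : n ≠ 0) (ω : Ω) :
    meanResultant (sample X n ω) ^ 2 * meanSinSq (sample X n ω) =
      sampleMean X θ₀ Real.cos n ω ^ 2 * sampleMean X θ₀ (fun t => Real.sin t ^ 2) n ω -
      2 * sampleMean X θ₀ Real.cos n ω * sampleMean X θ₀ Real.sin n ω *
        sampleMean X θ₀ (fun t => Real.sin t * Real.cos t) n ω +
      sampleMean X θ₀ Real.sin n ω ^ 2 *
        (1 - sampleMean X θ₀ (fun t => Real.sin t ^ 2) n ω) := by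
  have h := meanResultant_sq_mul_meanSinSq (sample X n ω) hn θ₀
  simp only [inv_mul_sum_sample] at h
  rw [inv_mul_sum_sample (fun t => Real.sin t ^ 2),
    inv_mul_sum_sample (fun t => Real.sin t * Real.cos t)] at h
  exact h

theorem meanResultant_one (θ : Fin 1 → ℝ) : meanResultant θ = 1 := by
  simp [meanResultant, Complex.norm_exp]

/-- The factor `√n` makes the identity hold for `n = 0` as well. -/
theorem concentrationMLE_sample_eq (n : ℕ) (ω : Ω) :
    √n * (concentrationMLE (sample X n ω) - κ) =
      √n * (besselAInv (meanResultant (sample X n ω)) - κ) := by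
  rcases n with - | n
  · simp
  · rw [concentrationMLE_eq (by omega)]

variable [MeasurableSpace Ω] {P : Measure Ω}

theorem aemeasurable_sample (hlaw : ∀ i, HasLaw (X i) (law θ₀ κ) P) (n : ℕ) :
    AEMeasurable (sample X n) P :=
  aemeasurable_pi_lambda _ fun i => (hlaw i).aemeasurable

variable [IsProbabilityMeasure P]

theorem ae_existsUnique_estimates (hX : iIndepFun X P) (hlaw : ∀ i, HasLaw (X i) (law θ₀ κ) P) :
    ∀ᵐ ω ∂P, ∀ n : ℕ, 2 ≤ n → meanSinSq (sample X n ω) ≠ 0 ∧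
      (∃! k, IsHybridSME (sample X n ω) k) ∧ ∃! k, IsConcentrationMLE (sample X n ω) k := by
  filter_upwards [ae_sin_sub_ne_zero hX hlaw] with ω hω n hn
  have hs : Real.sin (sample X n ω ⟨0, by omega⟩ - sample X n ω ⟨1, by omega⟩) ≠ 0 := hω
  have ha := meanSinSq_ne_zero hs
  refine ⟨ha, ⟨_, (isHybridSME_iff ha).2 rfl, fun k hk => (isHybridSME_iff ha).1 hk⟩, ?_⟩
  obtain ⟨k, hk⟩ := exists_besselA_eq (meanResultant_nonneg _) (meanResultant_lt_one hs)
  have hn' : n ≠ 0 := by omega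
  exact ⟨k, (isConcentrationMLE_iff hn').2 hk, fun k' hk' => strictMono_besselA.injective
    (((isConcentrationMLE_iff hn').1 hk').trans hk.symm)⟩

/-- Almost sure limits of the statistics entering the two estimators. -/
theorem ae_tendsto_statistics (hκ : 0 < κ) (hX : iIndepFun X P)
    (hlaw : ∀ i, HasLaw (X i) (law θ₀ κ) P) : ∀ᵐ ω ∂P,
    Tendsto (fun n => sampleMean X θ₀ Real.cos n ω) atTop (𝓝 (besselA 1 κ)) ∧
    Tendsto (fun n => sampleMean X θ₀ Real.sin n ω) atTop (𝓝 0) ∧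
    Tendsto (fun n => sampleMean X θ₀ (fun t => Real.sin t ^ 2) n ω) atTop
      (𝓝 (besselA 1 κ / κ)) ∧
    Tendsto (fun n => sampleMean X θ₀ (fun t => Real.sin t * Real.cos t) n ω) atTop (𝓝 0) ∧
    Tendsto (fun n => meanResultant (sample X n ω)) atTop (𝓝 (besselA 1 κ)) ∧
    Tendsto (fun n => meanSinSq (sample X n ω)) atTop (𝓝 (besselA 1 κ / κ)) := by
  have hA := besselA_pos hκ
  have hc := tendsto_sampleMean hX hlaw Real.continuous_cos Real.cos_periodic
  have hs := tendsto_sampleMean hX hlaw Real.continuous_sin Real.sin_periodic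
  have hq := tendsto_sampleMean (f := fun t => Real.sin t ^ 2) hX hlaw (by fun_prop)
    (fun t => by simp)
  have hp := tendsto_sampleMean (f := fun t => Real.sin t * Real.cos t) hX hlaw (by fun_prop)
    (fun t => by simp)
  rw [← besselA_one_eq] at hc
  rw [expect_sin hκ.ne'] at hs
  rw [expect_sin_sq hκ.ne'] at hq
  rw [expect_sin_mul_cos hκ.ne'] at hp
  filter_upwards [hc, hs, hq, hp] with ω hc hs hq hp
  have hr : Tendsto (fun n => meanResultant (sample X n ω)) atTop (𝓝 (besselA 1 κ)) := by
    have h := ((hc.pow 2).add (hs.pow 2)).sqrt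
    rw [zero_pow two_ne_zero, add_zero, Real.sqrt_sq hA.le] at h
    refine h.congr fun n => ?_
    rw [← meanResultant_sample_sq, Real.sqrt_sq (meanResultant_nonneg _)]
  refine ⟨hc, hs, hq, hp, hr, ?_⟩
  have h := ((((hc.pow 2).mul hq).sub (((hc.const_mul 2).mul hs).mul hp)).add
    ((hs.pow 2).mul (hq.const_sub 1))).div (hr.pow 2) (by positivity)
  rw [show (besselA 1 κ ^ 2 * (besselA 1 κ / κ) - 2 * besselA 1 κ * 0 * 0 +
    0 ^ 2 * (1 - besselA 1 κ / κ)) / besselA 1 κ ^ 2 = besselA 1 κ / κ by field_simp; ring] at h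
  refine h.congr' ?_
  filter_upwards [eventually_ne_atTop 0, hr.eventually_ne hA.ne'] with n hn hr0
  rw [Pi.div_apply, div_eq_iff (pow_ne_zero 2 hr0), mul_comm (meanSinSq _),
      meanResultant_sample_sq_mul hn]

/-- The formula fails at most for `n = 0`, where the factor `√n` vanishes. -/
theorem ae_hybridSME_eq (hX : iIndepFun X P) (hlaw : ∀ i, HasLaw (X i) (law θ₀ κ) P) :
    ∀ᵐ ω ∂P, ∀ n : ℕ, √n * (hybridSME (sample X n ω) - κ) =
      √n * (meanResultant (sample X n ω) / meanSinSq (sample X n ω) - κ) := by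
  filter_upwards [ae_existsUnique_estimates hX hlaw] with ω hω n
  rcases n with - | - | n
  · simp
  · rw [hybridSME_eq (Or.inr (by rw [meanResultant_one]; exact one_ne_zero))]
  · rw [hybridSME_eq (Or.inl (hω (n + 2) (by omega)).1)]

/-- The linearization of the score matching estimator `r / a`: with `c`, `s` the means of cosine
and sine of the angles measured from the true orientation and `q` that of `sin²`, both `r - c` and
`a - q` are `s` times a quantity that vanishes in the limit. -/
theorem hasAsymptoticVariance_hybridSME (hκ : 0 < κ) (hX : iIndepFun X P)
    (hlaw : ∀ i, HasLaw (X i) (law θ₀ κ) P) :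
    HasAsymptoticVariance P (fun n ω => hybridSME (sample X n ω)) κ (varSME κ) := by
  refine ⟨varSME_pos hκ, ?_⟩
  have hA := besselA_pos hκ
  set A := besselA 1 κ with hAdef
  -- The factor `κ / A` is the inverse of the limit of `meanSinSq`, so that `D → 1` below.
  let f : ℝ → ℝ := fun t => κ / A * (Real.cos t - κ * Real.sin t ^ 2)
  have hfc : Continuous f := by fun_prop
  have hf0 : expect κ f = 0 := by
    have h := expect_linear (κ := κ) (f := fun t => Real.cos t - κ * Real.sin t ^ 2)
      (g := fun _ => 1) (by fun_prop) continuous_const (κ / A) 0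
    simpa [expect_influence] using h
  have hf2 : expect κ (fun t => f t ^ 2) = varSME κ := by
    have h := expect_linear (κ := κ) (f := fun t => (Real.cos t - κ * Real.sin t ^ 2) ^ 2)
      (g := fun _ => 1) (by fun_prop) continuous_const ((κ / A) ^ 2) 0
    rw [expect_influence_sq hκ.ne'] at h
    simp only [zero_mul, add_zero] at h
    simp only [f, mul_pow]
    rw [h, varSME_eq hκ, ← hAdef]
    field_simp
  have hU := tendstoInDistribution_sampleMean hX hlaw hfc (fun t => by simp [f]) hf0
  rw [hf2] at hU
  have hV := tendstoInDistribution_sampleMean hX hlaw Real.continuous_sin Real.sin_periodic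
    (expect_sin hκ.ne')
  have hrm := fun n => (measurable_meanResultant (n := n)).comp_aemeasurable
    (aemeasurable_sample hlaw n)
  have ham := fun n => (measurable_meanSinSq (n := n)).comp_aemeasurable
    (aemeasurable_sample hlaw n)
  have hm := fun (g : ℝ → ℝ) (hg : Measurable g) n => aemeasurable_sampleMean hlaw hg n
  have hcm := hm _ Real.measurable_cos
  have hsm := hm _ Real.measurable_sin
  have hqm := hm (fun t => Real.sin t ^ 2) (by fun_prop)
  have hpm := hm (fun t => Real.sin t * Real.cos t) (by fun_prop)
  simp only [Function.comp_def] at hrm ham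
  have hTm : ∀ n : ℕ, AEMeasurable (fun ω => √n * (hybridSME (sample X n ω) - κ)) P := fun n =>
    ((((hrm n).div (ham n)).sub_const κ).const_mul √n).congr (by
      filter_upwards [ae_hybridSME_eq hX hlaw] with ω hω using (hω n).symm)
  refine hU.of_eventually_eq_mul_add hV
    (E := fun n ω => κ / A * (sampleMean X θ₀ Real.sin n ω /
        (meanResultant (sample X n ω) + sampleMean X θ₀ Real.cos n ω) -
      κ * ((sampleMean X θ₀ Real.sin n ω *
          (1 - 2 * sampleMean X θ₀ (fun t => Real.sin t ^ 2) n ω) -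
        2 * sampleMean X θ₀ Real.cos n ω *
          sampleMean X θ₀ (fun t => Real.sin t * Real.cos t) n ω) /
        meanResultant (sample X n ω) ^ 2)))
    (D := fun n ω => A / κ / meanSinSq (sample X n ω)) ?_
    (fun n => (ham n).const_div _) hTm ?_ ?_ ?_
  · intro n
    have h1 := hrm n
    have h2 := hcm n
    have h3 := hsm n
    have h4 := hqm n
    have h5 := hpm n
    fun_prop
  · filter_upwards [ae_tendsto_statistics hκ hX hlaw] with ω ⟨hc, hs, hq, hp, hr, ha⟩
    have h := ((hs.div (hr.add hc) (by positivity)).sub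
      ((((hs.mul ((hq.const_mul 2).const_sub 1)).sub ((hc.const_mul 2).mul hp)).div (hr.pow 2)
        (by positivity)).const_mul κ)).const_mul (κ / A)
    convert! h using 2
    simp
  · filter_upwards [ae_tendsto_statistics hκ hX hlaw] with ω ⟨hc, hs, hq, hp, hr, ha⟩
    have h := (tendsto_const_nhds (x := A / κ)).div ha (by positivity)
    rwa [div_self (by positivity)] at h
  · filter_upwards [ae_tendsto_statistics hκ hX hlaw, ae_hybridSME_eq hX hlaw]
      with ω ⟨hc, hs, hq, hp, hr, ha⟩ hT
    filter_upwards [eventually_ne_atTop 0, hr.eventually_ne hA.ne',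
      (hr.add hc).eventually_ne (by positivity : A + A ≠ 0),
      ha.eventually_ne (by positivity : A / κ ≠ 0)] with n hn hr0 hrc0 ha0
    have hfm : sampleMean X θ₀ f n ω = κ / A * (sampleMean X θ₀ Real.cos n ω -
        κ * sampleMean X θ₀ (fun t => Real.sin t ^ 2) n ω) := by
      have h := sampleMean_linear (X := X) (θ₀ := θ₀) Real.cos (fun t => Real.sin t ^ 2) (κ / A)
        (-(κ / A * κ)) n ω
      have e : f = fun t => κ / A * Real.cos t + -(κ / A * κ) * Real.sin t ^ 2 := by
        ext t; simp only [f]; ring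
      rw [e, h]; ring
    rw [hT, hfm]
    have e1 := meanResultant_sample_sq (X := X) (θ₀ := θ₀) n ω
    have e2 := meanResultant_sample_sq_mul (X := X) (θ₀ := θ₀) hn ω
    generalize meanResultant (sample X n ω) = r at *
    generalize meanSinSq (sample X n ω) = a at *
    generalize sampleMean X θ₀ Real.cos n ω = c at *
    generalize sampleMean X θ₀ Real.sin n ω = s at *
    generalize sampleMean X θ₀ (fun t => Real.sin t ^ 2) n ω = q at *
    generalize sampleMean X θ₀ (fun t => Real.sin t * Real.cos t) n ω = p at *
    have d1 : s * (s / (r + c)) = r - c := by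
      rw [← mul_div_assoc, div_eq_iff hrc0]; linear_combination -e1
    have d2 : s * ((s * (1 - 2 * q) - 2 * c * p) / r ^ 2) = a - q := by
      rw [← mul_div_assoc, div_eq_iff (pow_ne_zero 2 hr0)]
      linear_combination q * e1 - e2
    have d3 : r / a - κ = A / κ / a * (κ / A * (r - κ * a)) := by field_simp
    rw [d3]
    linear_combination (-√n * (A / κ / a) * (κ / A)) * (d1 - κ * d2)

/-- The delta method for the maximum likelihood estimator, the inverse of `A₁` at the mean
resultant length. -/
theorem hasAsymptoticVariance_concentrationMLE (hκ : 0 < κ) (hX : iIndepFun X P)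
    (hlaw : ∀ i, HasLaw (X i) (law θ₀ κ) P) :
    HasAsymptoticVariance P (fun n ω => concentrationMLE (sample X n ω)) κ (varMLE κ) := by
  refine ⟨varMLE_pos hκ.ne', ?_⟩
  have hA := besselA_pos hκ
  have hv := varCos_pos κ
  set A := besselA 1 κ with hAdef
  set v := varCos κ with hvdef
  -- The factor `v⁻¹` is the derivative of the inverse function of `A₁`, so that `D → 1` below.
  let f : ℝ → ℝ := fun t => v⁻¹ * (Real.cos t - A)
  have hfc : Continuous f := by fun_prop
  have hfe : f = fun t => v⁻¹ * Real.cos t + -(v⁻¹ * A) * 1 := by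
    ext t; simp only [f]; ring
  have hf0 : expect κ f = 0 := by
    rw [hfe, expect_linear Real.continuous_cos continuous_const, expect_one, ← besselA_one_eq]
    ring
  have hf2 : expect κ (fun t => f t ^ 2) = varMLE κ := by
    have h := expect_linear (κ := κ) (f := fun t => (Real.cos t - A) ^ 2)
      (g := fun _ => 1) (by fun_prop) continuous_const (v⁻¹ ^ 2) 0
    have h2 : expect κ (fun t => Real.cos t ^ 2) - 2 * A * A + A ^ 2 = v := by
      rw [hvdef, varCos]; ring
    rw [expect_sq_sub Real.continuous_cos, ← besselA_one_eq, ← hAdef, h2] at h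
    simp only [zero_mul, add_zero] at h
    simp only [f, mul_pow]
    rw [h, varMLE_eq hκ.ne', ← hvdef]
    field_simp
  have hU := tendstoInDistribution_sampleMean hX hlaw hfc (fun t => by simp [f]) hf0
  rw [hf2] at hU
  have hV := tendstoInDistribution_sampleMean hX hlaw Real.continuous_sin Real.sin_periodic
    (expect_sin hκ.ne')
  have hrm := fun n => (measurable_meanResultant (n := n)).comp_aemeasurable
    (aemeasurable_sample hlaw n)
  have hcm := fun n => aemeasurable_sampleMean hlaw Real.measurable_cos n
  have hsm := fun n => aemeasurable_sampleMean hlaw Real.measurable_sin n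
  have hgm := fun n => measurable_besselAInv.comp_aemeasurable (hrm n)
  simp only [Function.comp_def] at hrm hgm
  have hder := hasDerivAt_besselAInv κ
  -- The slope of the inverse function at `A`, continuous there, carries the delta method.
  have hds : Measurable (dslope besselAInv A) := by
    have : dslope besselAInv A =
        fun x => if x = A then v⁻¹ else (x - A)⁻¹ * (besselAInv x - κ) := by
      ext x
      split_ifs with h
      · rw [h, dslope_same, hder.deriv]
      · rw [dslope_of_ne _ h, slope, hAdef, besselAInv_besselA, vsub_eq_sub, smul_eq_mul]
    rw [this]
    have := measurable_besselAInv
    exact Measurable.ite (measurableSet_singleton A) measurable_const (by fun_prop)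
  have hdc : ContinuousAt (dslope besselAInv A) A := continuousAt_dslope_same.2
    hder.differentiableAt
  refine hU.of_eventually_eq_mul_add hV
    (E := fun n ω => v⁻¹ * (sampleMean X θ₀ Real.sin n ω /
        (meanResultant (sample X n ω) + sampleMean X θ₀ Real.cos n ω)))
    (D := fun n ω => v * dslope besselAInv A (meanResultant (sample X n ω)))
    (fun n => ((hsm n).div ((hrm n).add (hcm n))).const_mul _)
    (fun n => (hds.comp_aemeasurable (hrm n)).const_mul _)
    (fun n => ?_) ?_ ?_ ?_
  · simp only [concentrationMLE_sample_eq]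
    exact ((hgm n).sub_const κ).const_mul _
  · filter_upwards [ae_tendsto_statistics hκ hX hlaw] with ω ⟨hc, hs, hq, hp, hr, ha⟩
    have h := (hs.div (hr.add hc) (by positivity)).const_mul v⁻¹
    rwa [zero_div, mul_zero] at h
  · filter_upwards [ae_tendsto_statistics hκ hX hlaw] with ω ⟨hc, hs, hq, hp, hr, ha⟩
    have h := (hdc.tendsto.comp hr).const_mul v
    rwa [dslope_same, hder.deriv, mul_inv_cancel₀ hv.ne'] at h
  · filter_upwards [ae_tendsto_statistics hκ hX hlaw] with ω ⟨hc, hs, hq, hp, hr, ha⟩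
    filter_upwards [eventually_ne_atTop 0,
      (hr.add hc).eventually_ne (by positivity : A + A ≠ 0)] with n hn hrc0
    have hfm : sampleMean X θ₀ f n ω = v⁻¹ * (sampleMean X θ₀ Real.cos n ω - A) := by
      rw [hfe, sampleMean_linear, sampleMean_const _ hn]; ring
    have e1 := meanResultant_sample_sq (X := X) (θ₀ := θ₀) n ω
    have hsl := sub_smul_dslope besselAInv A (meanResultant (sample X n ω))
    rw [concentrationMLE_sample_eq, hfm]
    rw [smul_eq_mul, hAdef, besselAInv_besselA, ← hAdef] at hsl
    rw [← hsl]
    generalize meanResultant (sample X n ω) = r at *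
    generalize sampleMean X θ₀ Real.cos n ω = c at *
    generalize sampleMean X θ₀ Real.sin n ω = s at *
    have d1 : s * (s / (r + c)) = r - c := by
      rw [← mul_div_assoc, div_eq_iff hrc0]; linear_combination -e1
    linear_combination (-√n * dslope besselAInv A r) * (v * v⁻¹) * d1 -
      (√n * dslope besselAInv A r * (r - A)) * mul_inv_cancel₀ hv.ne'

end Sample

end VonMises

theorem mainTheorem4 {Ω : Type*} [MeasurableSpace Ω] (P : Measure Ω) [IsProbabilityMeasure P] :
    (∀ (θ₀ κ : ℝ), 0 < κ → ∀ X : ℕ → Ω → ℝ,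
      iIndepFun X P → (∀ i, HasLaw (X i) (VonMises.law θ₀ κ) P) →
        (∀ n : ℕ, 2 ≤ n → ∀ᵐ ω ∂P,
          (∃! k, VonMises.IsHybridSME (VonMises.sample X n ω) k) ∧
          (∃! k, VonMises.IsConcentrationMLE (VonMises.sample X n ω) k)) ∧
        VonMises.HasAsymptoticVariance P
          (fun n ω => VonMises.hybridSME (VonMises.sample X n ω)) κ
          (κ * (2 * κ - 3 * VonMises.besselA 1 κ) / VonMises.besselA 1 κ ^ 2) ∧
        VonMises.HasAsymptoticVariance P
          (fun n ω => VonMises.concentrationMLE (VonMises.sample X n ω)) κ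
          (1 / (1 - VonMises.besselA 1 κ ^ 2 - VonMises.besselA 1 κ / κ)) ∧
        VonMises.IsAsymptoticRelativeEfficiency P
          (fun n ω => VonMises.hybridSME (VonMises.sample X n ω))
          (fun n ω => VonMises.concentrationMLE (VonMises.sample X n ω)) κ
          (VonMises.besselA 1 κ ^ 2 /
            ((2 * κ - 3 * VonMises.besselA 1 κ) *
              (κ - κ * VonMises.besselA 1 κ ^ 2 - VonMises.besselA 1 κ)))) ∧
    (Tendsto (fun κ : ℝ => κ * (2 * κ - 3 * VonMises.besselA 1 κ) / VonMises.besselA 1 κ ^ 2)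
      (𝓝[>] 0) (𝓝 2) ∧
     Tendsto (fun κ : ℝ => 1 / (1 - VonMises.besselA 1 κ ^ 2 - VonMises.besselA 1 κ / κ))
      (𝓝[>] 0) (𝓝 2) ∧
     Asymptotics.IsEquivalent atTop
      (fun κ : ℝ => κ * (2 * κ - 3 * VonMises.besselA 1 κ) / VonMises.besselA 1 κ ^ 2)
      (fun κ : ℝ => 2 * κ ^ 2) ∧
     Asymptotics.IsEquivalent atTop
      (fun κ : ℝ => 1 / (1 - VonMises.besselA 1 κ ^ 2 - VonMises.besselA 1 κ / κ))
      (fun κ : ℝ => 2 * κ ^ 2)) ∧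
    (Tendsto (fun κ : ℝ => VonMises.besselA 1 κ ^ 2 /
        ((2 * κ - 3 * VonMises.besselA 1 κ) *
          (κ - κ * VonMises.besselA 1 κ ^ 2 - VonMises.besselA 1 κ)))
      (𝓝[>] 0) (𝓝 1) ∧
     Tendsto (fun κ : ℝ => VonMises.besselA 1 κ ^ 2 /
        ((2 * κ - 3 * VonMises.besselA 1 κ) *
          (κ - κ * VonMises.besselA 1 κ ^ 2 - VonMises.besselA 1 κ)))
      atTop (𝓝 1)) := by
  refine ⟨fun θ₀ κ hκ X hX hlaw => ?_, ⟨VonMises.tendsto_varSME_zero,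
    VonMises.tendsto_varMLE_zero, VonMises.isEquivalent_varSME, VonMises.isEquivalent_varMLE⟩,
    ?_, ?_⟩
  · have hS := VonMises.hasAsymptoticVariance_hybridSME hκ hX hlaw
    have hM := VonMises.hasAsymptoticVariance_concentrationMLE hκ hX hlaw
    refine ⟨fun n hn => ?_, hS, hM, _, _, hS, hM, (VonMises.varMLE_div_varSME hκ).symm⟩
    filter_upwards [VonMises.ae_existsUnique_estimates hX hlaw] with ω hω using (hω n hn).2
  · refine VonMises.tendsto_varMLE_div_varSME_zero.congr' ?_
    filter_upwards [self_mem_nhdsWithin] with κ hκ using VonMises.varMLE_div_varSME hκ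
  · refine VonMises.tendsto_varMLE_div_varSME_atTop.congr' ?_
    filter_upwards [eventually_gt_atTop 0] with κ hκ using VonMises.varMLE_div_varSME hκ
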